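/- Proposition 3.3. Let $G$ be a (finite-dimensional, second countable) Lie group acting smoothly, freely and by isometries on a Riemannian manifold $M$. Suppose that the orbit space $B=M/G$ is a (Hausdorff, smooth) manifold such that the quotient map $\pi:M\to B$ is a smooth submersion, and let $B$ carry the submersion metric, i.e. the Riemannian metric for which $d\pi$ is isometric on horizontal vectors, the vectors orthogonal to $\ker d\pi$. Endow $TM$ and $TB$ with the symplectic forms $\bar\omega$ and $\omega$ obtained by pulling back the canonical symplectic forms $-d\lambda$ of $T^*M$ and $T^*B$ by the bundle maps $v\mapsto\langle v,\cdot\rangle$, and let $G$ act on $TM$ by derivatives. For $\xi$ in the Lie algebra $\mathfrak g$ of $G$ let $\xi_M$ be the vector field on $M$ generated by $\xi$. Then: (1) The action of $G$ on $(TM,\bar\omega)$ is Hamiltonian, with moment map $\Phi:TM\to\mathfrak g^*$ given by $\Phi(v)(\xi)=\langle v,\xi_M(p)\rangle$ for $v\in T_pM$: the action is smooth and preserves the symplectic form $\bar\omega$, and $\Phi$ is smooth, equivariant for the coadjoint action, and satisfies $d\langle\Phi,\xi\rangle=\bar\omega(\xi_{TM},\cdot)$ for all $\xi\in\mathfrak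 g$, where $\xi_{TM}$ is the vector field on $TM$ generated by $\xi$. (2) $\Phi^{-1}(0)$ is the set of horizontal vectors. (3) $\Phi$ meets $0$ cleanly, i.e. $\Phi^{-1}(0)$ is an embedded submanifold of $TM$ and $T_x(\Phi^{-1}(0))=\ker d\Phi_x$ for every $x\in\Phi^{-1}(0)$. The Marsden–Weinstein reduced space $TM/\!/G$ at $0$ exists, i.e. the orbit space $\Phi^{-1}(0)/G$ carries a smooth structure for which the projection $\rho:\Phi^{-1}(0)\to\Phi^{-1}(0)/G$ is a submersion, and a symplectic form $\omega_r$ with $\rho^*\omega_r=\bar\omega|_{\Phi^{-1}(0)}$; and $(TM/\!/G,\omega_r)$ is symplectomorphic to $(TB,\omega)$. -/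

import Mathlib

open scoped Manifold ContDiff Bundle

noncomputable section

/-! ### Differential forms on manifolds -/

section Forms

variable {E : Type*} [NormedAddCommGroup E] [NormedSpace ℝ E]
  {H : Type*} [TopologicalSpace H] (I : ModelWithCorners ℝ E H)
  {M : Type*} [TopologicalSpace M] [ChartedSpace H M]
  {E' : Type*} [NormedAddCommGroup E'] [NormedSpace ℝ E']
  {H' : Type*} [TopologicalSpace H'] (I' : ModelWithCorners ℝ E' H')
  {M' : Type*} [TopologicalSpace M'] [ChartedSpace H' M']

variable (M) in
/-- A (not necessarily smooth) real differential `n`-form on the manifold `M`. -/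
abbrev MForm (n : ℕ) : Type _ := ∀ x : M, TangentSpace I x [⋀^Fin n]→L[ℝ] ℝ

/-- The pullback `f^* η` of a form by a (differentiable) map. -/
def MForm.pullback {n : ℕ} (f : M → M') (η : MForm I' M' n) : MForm I M n := fun x =>
  (η (f x)).compContinuousLinearMap (mfderiv I I' f x)

/-- The expression of a form in the preferred chart around `x`: its pullback to the model vector
space by the inverse of that chart. It is meaningful on the target of the chart. -/
def MForm.inChart {n : ℕ} (η : MForm I M n) (x : M) : E → E [⋀^Fin n]→L[ℝ] ℝ := fun y =>
  (η ((extChartAt I x).symm y)).compContinuousLinearMap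
    (mfderivWithin 𝓘(ℝ, E) I (extChartAt I x).symm (Set.range I) y)

/-- A form is smooth if its coefficients in charts are smooth. -/
def MForm.IsSmooth {n : ℕ} (η : MForm I M n) : Prop :=
  ∀ x : M, ContDiffOn ℝ ∞ (MForm.inChart I η x) (extChartAt I x).target

/-- The exterior derivative of a form on a manifold, computed at `x` in the preferred
chart around `x`: push the form to the model space, differentiate, and pull back. -/
def MForm.extDeriv {n : ℕ} (η : MForm I M n) : MForm I M (n + 1) := fun x =>
  (extDerivWithin (MForm.inChart I η x) (Set.range I) (extChartAt I x x)).compContinuousLinearMap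
    (mfderiv I 𝓘(ℝ, E) (extChartAt I x) x)

/-- A symplectic form: a smooth, closed, nondegenerate 2-form. -/
structure MForm.IsSymplectic (η : MForm I M 2) : Prop where
  smooth : MForm.IsSmooth I η
  closed : MForm.extDeriv I η = 0
  nondegenerate : ∀ (x : M) (u : TangentSpace I x),
    (∀ v : TangentSpace I x, η x ![u, v] = 0) → u = 0

end Forms

/-! ### The canonical symplectic form of a cotangent bundle -/

section Cotangent

variable {E : Type*} [NormedAddCommGroup E] [NormedSpace ℝ E]
  {H : Type*} [TopologicalSpace H] (I : ModelWithCorners ℝ E H)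
  (M : Type*) [TopologicalSpace M] [ChartedSpace H M] [IsManifold I ∞ M]

/-- The cotangent bundle `T^*M`, as the bundle of continuous linear maps from the tangent bundle
to the trivial line bundle. -/
abbrev CotangentBundle : Type _ :=
  Bundle.TotalSpace (E →L[ℝ] ℝ) (fun x : M => TangentSpace I x →L[ℝ] Bundle.Trivial M ℝ x)

/-- The model with corners of the cotangent bundle. -/
abbrev cotangentModel : ModelWithCorners ℝ (E × (E →L[ℝ] ℝ)) (ModelProd H (E →L[ℝ] ℝ)) :=
  I.prod 𝓘(ℝ, E →L[ℝ] ℝ)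

/-- The canonical (Liouville) 1-form `λ` on `T^*M`: `λ_α(w) = α(d(proj)_α w)`. -/
def liouvilleForm : MForm (cotangentModel I) (CotangentBundle I M) 1 := fun α =>
  ContinuousAlternatingMap.ofSubsingleton ℝ _ ℝ (0 : Fin 1)
    (ContinuousLinearMap.comp (α.2 : TangentSpace I α.1 →L[ℝ] ℝ)
      (mfderiv (cotangentModel I) I
        (Bundle.TotalSpace.proj : CotangentBundle I M → M) α))

/-- The canonical symplectic form `-dλ` on `T^*M`. -/
def canonicalForm : MForm (cotangentModel I) (CotangentBundle I M) 2 :=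
  -MForm.extDeriv (cotangentModel I) (liouvilleForm I M)

end Cotangent

/-! ### Riemannian metrics and submersions -/

section Riemannian

variable {E : Type*} [NormedAddCommGroup E] [NormedSpace ℝ E]
  {H : Type*} [TopologicalSpace H] (I : ModelWithCorners ℝ E H)
  (M : Type*) [TopologicalSpace M] [ChartedSpace H M] [IsManifold I ∞ M]
  [Bundle.RiemannianBundle (fun x : M => TangentSpace I x)]
  {E' : Type*} [NormedAddCommGroup E'] [NormedSpace ℝ E']
  {H' : Type*} [TopologicalSpace H'] (I' : ModelWithCorners ℝ E' H')
  {B : Type*} [TopologicalSpace B] [ChartedSpace H' B]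

/-- The bundle map `TM → T^*M`, `v ↦ ⟨v, ·⟩`, given by the Riemannian metric. -/
def metricFlat : TangentBundle I M → CotangentBundle I M := fun v => ⟨v.1, innerSL ℝ v.2⟩

/-- The symplectic form on `TM` obtained by pulling back the canonical symplectic form of `T^*M`
by the Riemannian metric. -/
def tangentSymplecticForm : MForm I.tangent (TangentBundle I M) 2 :=
  MForm.pullback I.tangent (cotangentModel I) (metricFlat I M) (canonicalForm I M)

variable {M}

/-- A tangent vector is horizontal for `q` if it is orthogonal to the vertical space, the kernel
of the differential of `q` at its foot point. -/
def IsHorizontal (q : M → B) (p : M) (v : TangentSpace I p) : Prop :=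
  ∀ w : TangentSpace I p, mfderiv I I' q p w = 0 → inner ℝ v w = 0

/-- A Riemannian submersion: a smooth submersion whose differential is isometric on horizontal
vectors. -/
structure IsRiemannianSubmersion [Bundle.RiemannianBundle (fun b : B => TangentSpace I' b)]
    (q : M → B) : Prop where
  isSubmersion : Manifold.IsSubmersion I I' ∞ q
  isometric : ∀ (p : M) (v w : TangentSpace I p),
    IsHorizontal I I' q p v → IsHorizontal I I' q p w →
      inner ℝ (mfderiv I I' q p v) (mfderiv I I' q p w) = inner ℝ v w

end Riemannian

/-! ### Hamiltonian actions -/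

section Hamiltonian

variable {EG : Type*} [NormedAddCommGroup EG] [NormedSpace ℝ EG]
  {HG : Type*} [TopologicalSpace HG] (IG : ModelWithCorners ℝ EG HG)
  {G : Type*} [TopologicalSpace G] [ChartedSpace HG G] [Group G]
  {E : Type*} [NormedAddCommGroup E] [NormedSpace ℝ E]
  {H : Type*} [TopologicalSpace H] (I : ModelWithCorners ℝ E H)

/-- The adjoint action of `g` on the Lie algebra `T_1 G`: the derivative at `1` of
`h ↦ g h g⁻¹`. As a vector space the Lie algebra is by definition the model space `EG`. -/
def lieAd (g : G) : EG →L[ℝ] EG := mfderiv IG IG (fun h : G => g * h * g⁻¹) 1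

variable (G) in
/-- The infinitesimal action at `x`: the derivative at `1` of the orbit map `g ↦ g • x`.
It sends `ξ` in the Lie algebra `EG = T_1 G` to the value at `x = 1 • x` of the vector field
on `X` generated by `ξ`. -/
def infinitesimalAction {X : Type*} [TopologicalSpace X] [ChartedSpace H X] [MulAction G X]
    (x : X) : EG →L[ℝ] TangentSpace I x :=
  (mfderiv IG I (fun g : G => g • x) 1 : EG →L[ℝ] E)

/-- The smooth action of the Lie group `G` on the symplectic manifold `(X, η)` is Hamiltonian with
moment map `Φ : X → g^*`: it preserves `η`, and `Φ` is smooth, equivariant for the coadjoint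
action, and satisfies `d⟨Φ, ξ⟩ = η(ξ_X, ·)` for every `ξ` in the Lie algebra. -/
structure IsHamiltonianAction (G : Type*) [TopologicalSpace G] [ChartedSpace HG G] [Group G]
    {X : Type*} [TopologicalSpace X] [ChartedSpace H X] [MulAction G X]
    (η : MForm I X 2) (Φ : X → (EG →L[ℝ] ℝ)) : Prop where
  contMDiffSMul : ContMDiffSMul IG I ∞ G X
  isSymplectic : MForm.IsSymplectic I η
  invariant : ∀ g : G, MForm.pullback I I (fun x : X => g • x) η = η
  contMDiff : ContMDiff I 𝓘(ℝ, EG →L[ℝ] ℝ) ∞ Φ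
  equivariant : ∀ (g : G) (x : X) (ξ : EG), Φ (g • x) ξ = Φ x (lieAd IG g⁻¹ ξ)
  moment : ∀ (ξ : EG) (x : X) (w : TangentSpace I x),
    mfderiv I 𝓘(ℝ, ℝ) (fun y => Φ y ξ) x w = η x ![infinitesimalAction IG G I x ξ, w]

/-- The Marsden–Weinstein reduced space at level `0`, as a topological space: the space of
`G`-orbits in `Φ⁻¹(0)`. -/
abbrev ReducedSpace (G : Type*) [Group G] {X : Type*} [MulAction G X]
    {V : Type*} [Zero V] (Φ : X → V) : Type _ :=
  Quotient ((MulAction.orbitRel G X).comap (Subtype.val : (Φ ⁻¹' {0} : Set X) → X))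

/-- The projection of the zero level onto the reduced space. -/
def ReducedSpace.mk (G : Type*) [Group G] {X : Type*} [MulAction G X]
    {V : Type*} [Zero V] (Φ : X → V) : (Φ ⁻¹' {0} : Set X) → ReducedSpace G Φ :=
  Quotient.mk _

end Hamiltonian

/-! ### Clean intersection and symplectic reduction -/

section Reduction

variable {E : Type*} [NormedAddCommGroup E] [NormedSpace ℝ E]
  {H : Type*} [TopologicalSpace H] (I : ModelWithCorners ℝ E H)
  {X : Type*} [TopologicalSpace X] [ChartedSpace H X]
  {V : Type*} [NormedAddCommGroup V] [NormedSpace ℝ V]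
  {EZ : Type*} [NormedAddCommGroup EZ] [NormedSpace ℝ EZ]
  {HZ : Type*} [TopologicalSpace HZ] (IZ : ModelWithCorners ℝ EZ HZ)
  {EY : Type*} [NormedAddCommGroup EY] [NormedSpace ℝ EY]
  {HY : Type*} [TopologicalSpace HY] (IY : ModelWithCorners ℝ EY HY)

/-- `Φ : X → V` meets `0` cleanly: the zero level `Z = Φ⁻¹(0)` carries the structure of a (finite
dimensional) embedded submanifold of `X`, and `T_z Z` is the kernel of `dΦ_z` at each `z` in `Z`.
As `Z` has the subspace topology, its smooth structure is determined by these conditions. -/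
structure CleanZeroLevel (Φ : X → V) where
  chartedSpace : ChartedSpace HZ (Φ ⁻¹' {0} : Set X)
  isManifold : IsManifold IZ ∞ (Φ ⁻¹' {0} : Set X)
  contMDiff_val : ContMDiff IZ I ∞ (Subtype.val : (Φ ⁻¹' {0} : Set X) → X)
  injective_mfderiv_val : ∀ z : (Φ ⁻¹' {0} : Set X),
    Function.Injective (mfderiv IZ I (Subtype.val : (Φ ⁻¹' {0} : Set X) → X) z)
  tangent_eq_ker : ∀ z : (Φ ⁻¹' {0} : Set X),
    Set.range (mfderiv IZ I (Subtype.val : (Φ ⁻¹' {0} : Set X) → X) z) =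
      {w : TangentSpace I (z : X) | mfderiv I 𝓘(ℝ, V) Φ (z : X) w = 0}

/-- The Marsden–Weinstein reduction at level `0` of a `G`-manifold `X` with 2-form `η` and moment
map `Φ` that meets `0` cleanly: a smooth structure on `Φ⁻¹(0)/G` for which the projection `ρ` from
`Z = Φ⁻¹(0)` is a submersion, and the symplectic form `η_r` on it with `ρ^* η_r = η|_Z`.
As `ρ` is a surjective submersion, these conditions determine the smooth structure and `η_r`. -/
structure MarsdenWeinsteinReduction (G : Type*) [Group G] [MulAction G X]
    (η : MForm I X 2) (Φ : X → V) extends CleanZeroLevel I IZ Φ where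
  chartedSpaceReduced : ChartedSpace HY (ReducedSpace G Φ)
  isManifoldReduced : IsManifold IY ∞ (ReducedSpace G Φ)
  isSubmersion : Manifold.IsSubmersion IZ IY ∞ (ReducedSpace.mk G Φ)
  form : MForm IY (ReducedSpace G Φ) 2
  isSymplectic : MForm.IsSymplectic IY form
  pullback_form : MForm.pullback IZ IY (ReducedSpace.mk G Φ) form =
    MForm.pullback IZ I (Subtype.val : (Φ ⁻¹' {0} : Set X) → X) η

/-- `(Y, η)` and `(N, θ)` are symplectomorphic: a diffeomorphism pulls `θ` back to `η`. -/
def Symplectomorphic {Y : Type*} [TopologicalSpace Y] [ChartedSpace HY Y] (η : MForm IY Y 2)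
    {N : Type*} [TopologicalSpace N] [ChartedSpace H N] (θ : MForm I N 2) : Prop :=
  ∃ f : Diffeomorph IY I Y N ∞, MForm.pullback IY I f θ = η

end Reduction

/-! ### The action by derivatives on the tangent bundle and its moment map -/

section TangentAction

variable {EG : Type*} [NormedAddCommGroup EG] [NormedSpace ℝ EG]
  {HG : Type*} [TopologicalSpace HG] (IG : ModelWithCorners ℝ EG HG)
  (G : Type*) [TopologicalSpace G] [ChartedSpace HG G] [Group G]
  {E : Type*} [NormedAddCommGroup E] [NormedSpace ℝ E]
  {H : Type*} [TopologicalSpace H] (I : ModelWithCorners ℝ E H)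
  (M : Type*) [TopologicalSpace M] [ChartedSpace H M]
  [MulAction G M]

/-- The induced action of `G` on `TM` by derivatives: `g • (p, v) = (g • p, d(g •)_p v)`. -/
@[reducible]
def tangentAction [ContMDiffSMul IG I ∞ G M] : MulAction G (TangentBundle I M) where
  smul g v := tangentMap I I (fun x : M => g • x) v
  one_smul v := by
    change tangentMap I I (fun x : M => (1 : G) • x) v = v
    have h : (fun x : M => (1 : G) • x) = id := by
      funext x
      exact one_smul G x
    rw [h, tangentMap_id]
    rfl
  mul_smul g h v := by
    change tangentMap I I (fun x : M => (g * h) • x) v =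
      tangentMap I I (fun x : M => g • x) (tangentMap I I (fun x : M => h • x) v)
    have hd : ∀ g : G, MDifferentiable I I (fun x : M => g • x) := fun g =>
      (ContMDiffSMul.contMDiff_const_smul (I := IG) (n := ∞) g).mdifferentiable (by simp)
    have e : (fun x : M => (g * h) • x) = (fun x : M => g • x) ∘ (fun x : M => h • x) := by
      funext x
      exact mul_smul g h x
    rw [e, tangentMap_comp (hd g) (hd h)]
    rfl

/-- The moment map of the action of `G` on `TM` induced by an isometric action on `M`:
`Φ(v)(ξ) = ⟨v, ξ_M(p)⟩` for `v` in `T_pM`. -/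
def tangentMomentMap [Bundle.RiemannianBundle (fun x : M => TangentSpace I x)]
    (v : TangentBundle I M) : EG →L[ℝ] ℝ :=
  (innerSL ℝ v.2 : TangentSpace I v.1 →L[ℝ] ℝ).comp (infinitesimalAction IG G I v.1)

end TangentAction

end

open scoped Manifold ContDiff Bundle

noncomputable section

set_option linter.unusedSectionVars false
set_option linter.style.haveILetI false

/-! ### Smoothness of maps into spaces of multilinear maps -/

section FiniteDimensional

/-- A map into a finite-dimensional space is smooth if it becomes smooth after composition with
each member of a finite separating family of continuous linear functionals. -/
theorem contMDiffAt_of_separating {W ι : Type*} [NormedAddCommGroup W] [NormedSpace ℝ W] [Finite ι]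
    (L : ι → W →L[ℝ] ℝ) (hL : ∀ w, (∀ i, L i w = 0) → w = 0)
    {E : Type*} [NormedAddCommGroup E] [NormedSpace ℝ E]
    {H : Type*} [TopologicalSpace H] {I : ModelWithCorners ℝ E H}
    {M : Type*} [TopologicalSpace M] [ChartedSpace H M] {f : M → W} {x : M} {n : WithTop ℕ∞}
    (h : ∀ i, ContMDiffAt I 𝓘(ℝ, ℝ) n (fun y => L i (f y)) x) :
    ContMDiffAt I 𝓘(ℝ, W) n f x := by
  have := Fintype.ofFinite ι
  let A : W →L[ℝ] (ι → ℝ) := ContinuousLinearMap.pi L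
  have hker : LinearMap.ker (A : W →ₗ[ℝ] (ι → ℝ)) = ⊥ := by
    rw [LinearMap.ker_eq_bot']
    intro w hw
    exact hL w fun i => congrFun hw i
  obtain ⟨g, hg⟩ := LinearMap.exists_leftInverse_of_injective _ hker
  have e : f = fun y => LinearMap.toContinuousLinearMap g (A (f y)) := by
    funext y
    exact (LinearMap.congr_fun hg (f y)).symm
  rw [e]
  exact (ContinuousLinearMap.contMDiff _).contMDiffAt.comp x (contMDiffAt_pi_space.2 h)

theorem contMDiffAt_clm_of_apply {F W : Type*} [NormedAddCommGroup F] [NormedSpace ℝ F]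
    [FiniteDimensional ℝ F] [NormedAddCommGroup W] [NormedSpace ℝ W] [FiniteDimensional ℝ W]
    {E : Type*} [NormedAddCommGroup E] [NormedSpace ℝ E]
    {H : Type*} [TopologicalSpace H] {I : ModelWithCorners ℝ E H}
    {M : Type*} [TopologicalSpace M] [ChartedSpace H M] {f : M → F →L[ℝ] W} {x : M}
    {n : WithTop ℕ∞} (h : ∀ v, ContMDiffAt I 𝓘(ℝ, W) n (fun y => f y v) x) :
    ContMDiffAt I 𝓘(ℝ, F →L[ℝ] W) n f x := by
  let b := Module.finBasis ℝ F
  let d := Module.finBasis ℝ W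
  refine contMDiffAt_of_separating
    (L := fun i : Fin (Module.finrank ℝ F) × Fin (Module.finrank ℝ W) =>
      (LinearMap.toContinuousLinearMap (d.coord i.2)).comp
        (ContinuousLinearMap.apply ℝ W (b i.1))) ?_ fun i => ?_
  · intro w hw
    have : (w : F →ₗ[ℝ] W) = 0 := b.ext fun i => d.ext_elem fun j => by
      simpa using hw (i, j)
    exact ContinuousLinearMap.coe_inj.1 this
  · exact (ContinuousLinearMap.contMDiff (LinearMap.toContinuousLinearMap (d.coord i.2))
      ).contMDiffAt.comp x (h (b i.1))

variable {V : Type*} [NormedAddCommGroup V] [NormedSpace ℝ V]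
  {E : Type*} [NormedAddCommGroup E] [NormedSpace ℝ E] [FiniteDimensional ℝ E]

theorem contDiffAt_continuousAlternatingMap_of_apply {k : ℕ} {f : V → E [⋀^Fin k]→L[ℝ] ℝ} {x : V}
    {n : WithTop ℕ∞} (h : ∀ v, ContDiffAt ℝ n (fun y => f y v) x) : ContDiffAt ℝ n f x := by
  let b := Module.finBasis ℝ E
  rw [← contMDiffAt_iff_contDiffAt]
  refine contMDiffAt_of_separating
    (L := fun i : Fin k → Fin (Module.finrank ℝ E) =>
      (ContinuousMultilinearMap.apply ℝ (fun _ : Fin k => E) ℝ (fun j => b (i j))).comp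
        (ContinuousAlternatingMap.toContinuousMultilinearMapCLM ℝ)) ?_ fun i => (h _).contMDiffAt
  intro w hw
  ext v
  have : w.toAlternatingMap.toMultilinearMap = 0 :=
    Module.Basis.ext_multilinear (fun _ => b) fun i => hw i
  exact DFunLike.congr_fun this v

theorem ContDiffAt.continuousAlternatingMap_compContinuousLinearMap
    {F : Type*} [NormedAddCommGroup F] [NormedSpace ℝ F] {k : ℕ}
    {f : V → F [⋀^Fin k]→L[ℝ] ℝ} {A : V → E →L[ℝ] F} {x : V} {n : WithTop ℕ∞}
    (hf : ContDiffAt ℝ n f x) (hA : ContDiffAt ℝ n A x) :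
    ContDiffAt ℝ n (fun y => (f y).compContinuousLinearMap (A y)) x := by
  refine contDiffAt_continuousAlternatingMap_of_apply fun v => ?_
  have h1 : ContDiffAt ℝ n (fun y =>
      ContinuousMultilinearMap.compContinuousLinearMapContinuousMultilinear ℝ
        (fun _ : Fin k => E) (fun _ : Fin k => F) ℝ (fun _ => A y)) x :=
    (ContinuousMultilinearMap.contDiff _).contDiffAt.comp x (contDiffAt_pi.2 fun _ => hA)
  have h2 : ContDiffAt ℝ n (fun y =>
      ContinuousAlternatingMap.toContinuousMultilinearMapCLM ℝ (f y)) x :=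
    (ContinuousLinearMap.contDiff _).contDiffAt.comp x hf
  exact (ContinuousLinearMap.contDiff
    (ContinuousMultilinearMap.apply ℝ (fun _ : Fin k => E) ℝ v)).contDiffAt.comp x
      (h1.clm_apply h2)

end FiniteDimensional

/-! ### Pullback and exterior derivative of forms on manifolds -/

namespace MForm

section

variable {E : Type*} [NormedAddCommGroup E] [NormedSpace ℝ E]
  {H : Type*} [TopologicalSpace H] {I : ModelWithCorners ℝ E H}
  {M : Type*} [TopologicalSpace M] [ChartedSpace H M]
  {E' : Type*} [NormedAddCommGroup E'] [NormedSpace ℝ E']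
  {H' : Type*} [TopologicalSpace H'] {I' : ModelWithCorners ℝ E' H'}
  {M' : Type*} [TopologicalSpace M'] [ChartedSpace H' M']
  {E'' : Type*} [NormedAddCommGroup E''] [NormedSpace ℝ E'']
  {H'' : Type*} [TopologicalSpace H''] {I'' : ModelWithCorners ℝ E'' H''}
  {M'' : Type*} [TopologicalSpace M''] [ChartedSpace H'' M'']

theorem pullback_apply {n : ℕ} (f : M → M') (η : MForm I' M' n) (x : M)
    (v : Fin n → TangentSpace I x) :
    pullback I I' f η x v = η (f x) (fun i => mfderiv I I' f x (v i)) := rfl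

theorem pullback_comp {n : ℕ} {f : M → M'} {g : M' → M''} (η : MForm I'' M'' n) {x : M}
    (hg : MDifferentiableAt I' I'' g (f x)) (hf : MDifferentiableAt I I' f x) :
    pullback I I'' (g ∘ f) η x =
      (pullback I' I'' g η (f x)).compContinuousLinearMap (mfderiv I I' f x) := by
  unfold pullback
  rw [mfderiv_comp x hg hf]
  rfl

theorem compContinuousLinearMap_congr {n : ℕ} (η : MForm I' M' n) {a b : M'} (h : a = b)
    {A B : E →L[ℝ] E'} (hAB : A = B) :
    ContinuousAlternatingMap.compContinuousLinearMap (η a : E' [⋀^Fin n]→L[ℝ] ℝ) A =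
      ContinuousAlternatingMap.compContinuousLinearMap (η b : E' [⋀^Fin n]→L[ℝ] ℝ) B := by
  subst h hAB
  rfl

theorem pullback_congr {n : ℕ} {f g : M → M'} (η : MForm I' M' n) {x : M}
    (h : f =ᶠ[nhds x] g) : pullback I I' f η x = pullback I I' g η x :=
  compContinuousLinearMap_congr (E := E) η (A := mfderiv I I' f x) (B := mfderiv I I' g x)
    h.eq_of_nhds
    h.mfderiv_eq

theorem pullback_neg {n : ℕ} (f : M → M') (η : MForm I' M' n) :
    pullback I I' f (-η) = -pullback I I' f η := rfl

theorem inChart_eq_pullback [I.Boundaryless] {n : ℕ} (η : MForm I M n) (x : M) :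
    inChart I η x = pullback 𝓘(ℝ, E) I (extChartAt I x).symm η := by
  funext y
  simp only [inChart, pullback, I.range_eq_univ, mfderivWithin_univ]
  rfl

end

section

variable {E : Type*} [NormedAddCommGroup E] [NormedSpace ℝ E] [FiniteDimensional ℝ E]
  {H : Type*} [TopologicalSpace H] {I : ModelWithCorners ℝ E H} [I.Boundaryless]
  {M : Type*} [TopologicalSpace M] [ChartedSpace H M] [IsManifold I ∞ M]
  {E' : Type*} [NormedAddCommGroup E'] [NormedSpace ℝ E'] [FiniteDimensional ℝ E']
  {H' : Type*} [TopologicalSpace H'] {I' : ModelWithCorners ℝ E' H'} [I'.Boundaryless]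
  {M' : Type*} [TopologicalSpace M'] [ChartedSpace H' M'] [IsManifold I' ∞ M']

theorem contMDiffAt_extChartAt_symm (x : M) {y : E} (hy : y ∈ (extChartAt I x).target) :
    ContMDiffAt 𝓘(ℝ, E) I ∞ (extChartAt I x).symm y :=
  (contMDiffOn_extChartAt_symm x).contMDiffAt ((isOpen_extChartAt_target x).mem_nhds hy)

theorem eventually_mdifferentiableAt {f : M → M'} {x : M} (hf : ContMDiffAt I I' ∞ f x) :
    ∀ᶠ y in nhds x, MDifferentiableAt I I' f y :=
  ((contMDiffAt_iff_contMDiffAt_nhds (n := 1) (by simp)).1 (hf.of_le (by simp))).mono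
    fun _ h => h.mdifferentiableAt (by simp)

/-- The pullback of a form to a vector space, as a differential form on that vector space. -/
def onSpace {k : ℕ} (η : MForm I' M' k) (c : E → M') : E → E [⋀^Fin k]→L[ℝ] ℝ :=
  pullback 𝓘(ℝ, E) I' c η

/-- The pullback of a form to a vector space, in terms of its expression in a chart. -/
theorem onSpace_eventuallyEq_inChart {k : ℕ} (η : MForm I' M' k) {c : E → M'} {v : E}
    (hc : ContMDiffAt 𝓘(ℝ, E) I' ∞ c v) :
    η.onSpace c =ᶠ[nhds v] fun y =>
      (inChart I' η (c v) (extChartAt I' (c v) (c y))).compContinuousLinearMap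
        (fderiv ℝ (fun z => extChartAt I' (c v) (c z)) y) := by
  have h2 : ∀ᶠ y in nhds v, c y ∈ (extChartAt I' (c v)).source :=
    hc.continuousAt.preimage_mem_nhds (extChartAt_source_mem_nhds (c v))
  filter_upwards [eventually_mdifferentiableAt hc, h2.eventually_nhds] with y hy1 hy2
  have hs : c y ∈ (extChartAt I' (c v)).source := hy2.self_of_nhds
  have hd : MDifferentiableAt 𝓘(ℝ, E) 𝓘(ℝ, E') (fun z => extChartAt I' (c v) (c z)) y :=
    ((contMDiffAt_extChartAt' (I := I') (n := 1) (x := c v) (x' := c y)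
      (by simpa using hs)).mdifferentiableAt (by simp)).comp y hy1
  rw [inChart_eq_pullback, ← mfderiv_eq_fderiv]
  have hsymm := (contMDiffAt_extChartAt_symm (I := I') (c v)
    ((extChartAt I' (c v)).map_source hs)).mdifferentiableAt (by simp)
  refine Eq.trans ?_ (pullback_comp (f := fun z => extChartAt I' (c v) (c z))
    (g := (extChartAt I' (c v)).symm) η hsymm hd)
  refine pullback_congr η ?_
  filter_upwards [hy2] with z hz
  exact ((extChartAt I' (c v)).left_inv hz).symm

theorem contDiffAt_extChartAt_comp {c : E → M'} {v : E} (hc : ContMDiffAt 𝓘(ℝ, E) I' ∞ c v) :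
    ContDiffAt ℝ ∞ (fun z => extChartAt I' (c v) (c z)) v :=
  ((contMDiffAt_extChartAt (I := I') (n := ∞)).comp v hc).contDiffAt

theorem IsSmooth.contDiffAt_inChart {k : ℕ} {η : MForm I' M' k} (hη : IsSmooth I' η) (x : M') :
    ContDiffAt ℝ ∞ (inChart I' η x) (extChartAt I' x x) :=
  (hη x).contDiffAt ((isOpen_extChartAt_target x).mem_nhds (mem_extChartAt_target x))

theorem IsSmooth.contDiffAt_onSpace {k : ℕ} {η : MForm I' M' k} (hη : IsSmooth I' η)
    {c : E → M'} {v : E} (hc : ContMDiffAt 𝓘(ℝ, E) I' ∞ c v) :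
    ContDiffAt ℝ ∞ (η.onSpace c) v := by
  have hF := contDiffAt_extChartAt_comp hc
  refine ContDiffAt.congr_of_eventuallyEq ?_ (onSpace_eventuallyEq_inChart η hc)
  refine ContDiffAt.continuousAlternatingMap_compContinuousLinearMap ?_
    (hF.fderiv_right (by simp))
  exact (hη.contDiffAt_inChart (c v)).comp v hF

/-- The exterior derivative commutes with pullback to a vector space. -/
theorem IsSmooth.extDeriv_onSpace {k : ℕ} {η : MForm I' M' k} (hη : IsSmooth I' η)
    {c : E → M'} {v : E} (hc : ContMDiffAt 𝓘(ℝ, E) I' ∞ c v) :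
    _root_.extDeriv (η.onSpace c) v = (MForm.extDeriv I' η).onSpace c v := by
  have hF := contDiffAt_extChartAt_comp hc
  rw [Filter.EventuallyEq.extDeriv_eq (onSpace_eventuallyEq_inChart η hc)]
  refine (_root_.extDeriv_pullback (f := fun z => extChartAt I' (c v) (c z)) (r := ∞)
      ((hη.contDiffAt_inChart (c v)).differentiableAt (by simp)) hF
      (by simpa using ENat.LEInfty.out)).trans ?_
  unfold onSpace pullback MForm.extDeriv
  rw [I'.range_eq_univ, extDerivWithin_univ]
  have hd : fderiv ℝ (fun z => extChartAt I' (c v) (c z)) v =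
      (mfderiv I' 𝓘(ℝ, E') (extChartAt I' (c v)) (c v)).comp (mfderiv 𝓘(ℝ, E) I' c v) := by
    rw [← mfderiv_eq_fderiv]
    exact mfderiv_comp v ((contMDiffAt_extChartAt (I := I') (n := 1)).mdifferentiableAt (by simp))
      (hc.mdifferentiableAt (by simp))
  rw [hd]
  rfl

theorem isSmooth_of_contDiffAt_onSpace {k : ℕ} {η : MForm I M k}
    (h : ∀ (c : E → M) (v : E), ContMDiffAt 𝓘(ℝ, E) I ∞ c v → ContDiffAt ℝ ∞ (η.onSpace c) v) :
    IsSmooth I η := by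
  intro x y hy
  rw [inChart_eq_pullback]
  exact (h _ _ (contMDiffAt_extChartAt_symm x hy)).contDiffWithinAt

theorem onSpace_pullback {k : ℕ} (η : MForm I' M' k) {f : M → M'} (hf : ContMDiff I I' ∞ f)
    {V : Type*} [NormedAddCommGroup V] [NormedSpace ℝ V] [FiniteDimensional ℝ V] {c : V → M} {v : V}
    (hc : ContMDiffAt 𝓘(ℝ, V) I ∞ c v) :
    (pullback I I' f η).onSpace c =ᶠ[nhds v] η.onSpace (f ∘ c) := by
  filter_upwards [eventually_mdifferentiableAt hc] with y hy
  exact (pullback_comp η (hf.mdifferentiable (by simp) _) hy).symm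

/-- The pullback of a smooth form by a smooth map is smooth. -/
theorem IsSmooth.pullback {k : ℕ} {η : MForm I' M' k} (hη : IsSmooth I' η)
    {f : M → M'} (hf : ContMDiff I I' ∞ f) : IsSmooth I (pullback I I' f η) :=
  isSmooth_of_contDiffAt_onSpace fun _ _ hc =>
    (hη.contDiffAt_onSpace (hf.contMDiffAt.comp _ hc)).congr_of_eventuallyEq
      (onSpace_pullback η hf hc)

theorem extDeriv_eq_onSpace {k : ℕ} (η : MForm I M k) (x : M) :
    MForm.extDeriv I η x =
      (_root_.extDeriv (η.onSpace (extChartAt I x).symm)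
        (extChartAt I x x)).compContinuousLinearMap (mfderiv I 𝓘(ℝ, E) (extChartAt I x) x) := by
  unfold MForm.extDeriv
  rw [I.range_eq_univ, extDerivWithin_univ, inChart_eq_pullback]
  rfl

theorem onSpace_extChartAt_symm_comp {k : ℕ} (η : MForm I M k) (x : M) :
    (η.onSpace (extChartAt I x).symm (extChartAt I x x)).compContinuousLinearMap
      (mfderiv I 𝓘(ℝ, E) (extChartAt I x) x) = η x := by
  have hd := (contMDiffAt_extChartAt (I := I) (x := x) (n := 1)).mdifferentiableAt (by simp)
  have hs := (contMDiffAt_extChartAt_symm (I := I) x (mem_extChartAt_target x)).mdifferentiableAt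
    (by simp)
  refine (pullback_comp η hs hd).symm.trans ?_
  have : (extChartAt I x).symm ∘ extChartAt I x =ᶠ[nhds x] id := by
    filter_upwards [extChartAt_source_mem_nhds (I := I) x] with y hy
    exact (extChartAt I x).left_inv hy
  rw [pullback_congr η this]
  ext v
  simp [MForm.pullback_apply]

/-- The exterior derivative of a form on a manifold commutes with pullback. -/
theorem IsSmooth.extDeriv_pullback {k : ℕ} {η : MForm I' M' k} (hη : IsSmooth I' η)
    {f : M → M'} (hf : ContMDiff I I' ∞ f) :
    MForm.extDeriv I (MForm.pullback I I' f η) = MForm.pullback I I' f (MForm.extDeriv I' η) := by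
  funext x
  have hc := contMDiffAt_extChartAt_symm (I := I) x (mem_extChartAt_target x)
  have hfc : ContMDiffAt 𝓘(ℝ, E) I' ∞ (f ∘ (extChartAt I x).symm) (extChartAt I x x) :=
    hf.contMDiffAt.comp _ hc
  rw [extDeriv_eq_onSpace, Filter.EventuallyEq.extDeriv_eq (onSpace_pullback η hf hc),
    hη.extDeriv_onSpace hfc, ← (onSpace_pullback _ hf hc).eq_of_nhds,
    onSpace_extChartAt_symm_comp]

theorem IsSmooth.neg {k : ℕ} {η : MForm I M k} (hη : IsSmooth I η) : IsSmooth I (-η) :=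
  fun x => (hη x).neg

theorem extDeriv_neg {k : ℕ} (η : MForm I M k) :
    MForm.extDeriv I (-η) = -MForm.extDeriv I η := by
  funext x
  have h : (-η).onSpace (extChartAt I x).symm = (-1 : ℝ) • η.onSpace (extChartAt I x).symm := by
    funext y
    exact (neg_one_smul ℝ (η.onSpace (extChartAt I x).symm y)).symm
  rw [Pi.neg_apply, extDeriv_eq_onSpace, extDeriv_eq_onSpace, h, extDeriv_smul, neg_smul, one_smul]
  rfl

theorem IsSmooth.extDeriv {k : ℕ} {η : MForm I M k} (hη : IsSmooth I η) :
    IsSmooth I (MForm.extDeriv I η) := by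
  intro x y hy
  rw [inChart_eq_pullback]
  have h : ContDiffAt ℝ ∞ (_root_.extDeriv (η.onSpace (extChartAt I x).symm)) y :=
    (ContinuousLinearMap.contDiff (ContinuousAlternatingMap.alternatizeUncurryFinCLM ℝ E ℝ)
      ).contDiffAt.comp y
      ((hη.contDiffAt_onSpace (contMDiffAt_extChartAt_symm x hy)).fderiv_right (by simp))
  refine (h.congr_of_eventuallyEq ?_).contDiffWithinAt
  filter_upwards [(isOpen_extChartAt_target x).mem_nhds hy] with z hz
  exact (hη.extDeriv_onSpace (contMDiffAt_extChartAt_symm x hz)).symm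

theorem IsSmooth.extDeriv_extDeriv {k : ℕ} {η : MForm I M k} (hη : IsSmooth I η) :
    MForm.extDeriv I (MForm.extDeriv I η) = 0 := by
  funext x
  have hc := contMDiffAt_extChartAt_symm (I := I) x (mem_extChartAt_target x)
  have h : (MForm.extDeriv I η).onSpace (extChartAt I x).symm =ᶠ[nhds (extChartAt I x x)]
      _root_.extDeriv (η.onSpace (extChartAt I x).symm) := by
    filter_upwards [extChartAt_target_mem_nhds (I := I) x] with z hz
    exact (hη.extDeriv_onSpace (contMDiffAt_extChartAt_symm x hz)).symm
  rw [extDeriv_eq_onSpace, h.extDeriv_eq,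
    extDeriv_extDeriv_apply (hη.contDiffAt_onSpace hc) (by simpa using ENat.LEInfty.out)]
  rfl

end
end MForm

/-! ### Smoothness of derivatives of maps between manifolds -/

section

variable {E : Type*} [NormedAddCommGroup E] [NormedSpace ℝ E]
  {H : Type*} [TopologicalSpace H] {I : ModelWithCorners ℝ E H}
  {M : Type*} [TopologicalSpace M] [ChartedSpace H M] [IsManifold I ∞ M]
  {E' : Type*} [NormedAddCommGroup E'] [NormedSpace ℝ E']
  {H' : Type*} [TopologicalSpace H'] {I' : ModelWithCorners ℝ E' H'}
  {M' : Type*} [TopologicalSpace M'] [ChartedSpace H' M'] [IsManifold I' ∞ M']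

theorem ContMDiffAt.mfderiv_apply_section {f : M → M'} {x : M} {v : ∀ y : M, TangentSpace I y}
    (hf : ContMDiffAt I I' ∞ f x)
    (hv : ContMDiffAt I I.tangent ∞ (fun y => (⟨y, v y⟩ : TangentBundle I M)) x) :
    ContMDiffAt I I'.tangent ∞
      (fun y => (⟨f y, mfderiv I I' f y (v y)⟩ : TangentBundle I' M')) x := by
  have h := hf.mfderiv_const (m := ∞) (by simp)
  exact ContMDiffAt.clm_apply_of_inCoordinates h hv hf

theorem contMDiffAt_const_section (u : E) (x : E) :
    ContMDiffAt 𝓘(ℝ, E) 𝓘(ℝ, E).tangent ∞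
      (fun y : E => (⟨y, u⟩ : TangentBundle 𝓘(ℝ, E) E)) x := by
  have := (contMDiffAt_vectorSpace_iff_contDiffAt (𝕜 := ℝ) (E := E) (n := ∞)
    (V := fun _ => u) (x := x)).2 contDiffAt_const
  exact this

end

/-! ### The Liouville form -/

section

variable {E : Type*} [NormedAddCommGroup E] [NormedSpace ℝ E] [FiniteDimensional ℝ E]
  {H : Type*} [TopologicalSpace H] {I : ModelWithCorners ℝ E H} [I.Boundaryless]
  {M : Type*} [TopologicalSpace M] [ChartedSpace H M] [IsManifold I ∞ M]

theorem liouvilleForm_apply (α : CotangentBundle I M)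
    (w : Fin 1 → TangentSpace (cotangentModel I) α) :
    liouvilleForm I M α w =
      α.2 (mfderiv (cotangentModel I) I (Bundle.TotalSpace.proj : CotangentBundle I M → M) α
        (w 0)) := rfl

theorem isSmooth_liouvilleForm : MForm.IsSmooth (cotangentModel I) (liouvilleForm I M) := by
  refine MForm.isSmooth_of_contDiffAt_onSpace fun c v hc => ?_
  refine contDiffAt_continuousAlternatingMap_of_apply fun u => ?_
  have hp : ContMDiff (cotangentModel I) I ∞
      (Bundle.TotalSpace.proj : CotangentBundle I M → M) := Bundle.contMDiff_proj _
  have hpc : ContMDiffAt 𝓘(ℝ, E × (E →L[ℝ] ℝ)) I ∞ (fun y => (c y).1) v :=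
    hp.contMDiffAt.comp v hc
  have h1 := hpc.mfderiv_apply_section (contMDiffAt_const_section (u 0) v)
  have h2 : ContMDiffAt 𝓘(ℝ, E × (E →L[ℝ] ℝ)) (I.prod 𝓘(ℝ, ℝ)) ∞
      (fun y => Bundle.TotalSpace.mk' ℝ (E := Bundle.Trivial M ℝ) (c y).1
        ((c y).2 (mfderiv 𝓘(ℝ, E × (E →L[ℝ] ℝ)) I (fun y => (c y).1) y (u 0)))) v :=
    ContMDiffAt.clm_bundle_apply (F₁ := E) (F₂ := ℝ) (E₁ := fun x : M => TangentSpace I x)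
      (E₂ := Bundle.Trivial M ℝ) (b := fun y => (c y).1) (ϕ := fun y => (c y).2) hc h1
  rw [Bundle.contMDiffAt_totalSpace] at h2
  refine (h2.2.contDiffAt).congr_of_eventuallyEq ?_
  filter_upwards [MForm.eventually_mdifferentiableAt hc] with y hy
  have : mfderiv 𝓘(ℝ, E × (E →L[ℝ] ℝ)) I (fun y => (c y).1) y =
    (mfderiv (cotangentModel I) I (Bundle.TotalSpace.proj : CotangentBundle I M → M) (c y)).comp
      (mfderiv 𝓘(ℝ, E × (E →L[ℝ] ℝ)) (cotangentModel I) c y) :=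
    mfderiv_comp y (hp.mdifferentiable (by simp) _) hy
  rw [this]
  rfl

variable [Bundle.RiemannianBundle (fun x : M => TangentSpace I x)]
  [IsContMDiffRiemannianBundle I ∞ E (fun x : M => TangentSpace I x)]

theorem contMDiff_metricFlat : ContMDiff I.tangent (cotangentModel I) ∞ (metricFlat I M) := by
  obtain ⟨g, hg, hgi⟩ := IsContMDiffRiemannianBundle.exists_contMDiff (IB := I) (n := ∞) (F := E)
    (E := fun x : M => TangentSpace I x)
  have h := ContMDiff.clm_bundle_apply (F₁ := E) (F₂ := E →L[ℝ] ℝ)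
    (E₁ := fun x : M => TangentSpace I x)
    (E₂ := fun x : M => TangentSpace I x →L[ℝ] Bundle.Trivial M ℝ x)
    (b := fun v : TangentBundle I M => v.1) (ϕ := fun v : TangentBundle I M => g v.1)
    (v := fun v => v.2) (hg.comp (Bundle.contMDiff_proj _)) contMDiff_id
  convert h using 2 with v
  refine congrArg (Bundle.TotalSpace.mk v.1) ?_
  ext w
  exact hgi v.1 v.2 w

variable (I M) in
/-- The 1-form on the tangent bundle of a Riemannian manifold that corresponds to the Liouville
form: `v ↦ ⟨v, d(proj) ·⟩`. -/
def metricForm : MForm I.tangent (TangentBundle I M) 1 :=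
  MForm.pullback I.tangent (cotangentModel I) (metricFlat I M) (liouvilleForm I M)

theorem metricForm_apply (v : TangentBundle I M) (w : Fin 1 → TangentSpace I.tangent v) :
    metricForm I M v w =
      inner ℝ v.2 (mfderiv I.tangent I (Bundle.TotalSpace.proj : TangentBundle I M → M) v
        (w 0)) := by
  unfold metricForm
  rw [MForm.pullback_apply, liouvilleForm_apply]
  have h : mfderiv I.tangent I (Bundle.TotalSpace.proj : TangentBundle I M → M) v =
    (mfderiv (cotangentModel I) I (Bundle.TotalSpace.proj : CotangentBundle I M → M)
      (metricFlat I M v)).comp (mfderiv I.tangent (cotangentModel I) (metricFlat I M) v) :=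
    mfderiv_comp (g := (Bundle.TotalSpace.proj : CotangentBundle I M → M)) v
      ((Bundle.contMDiff_proj (n := 1) _).mdifferentiable (by simp) _)
      (contMDiff_metricFlat.mdifferentiable (by simp) _)
  rw [h]
  rfl

theorem isSmooth_metricForm : MForm.IsSmooth I.tangent (metricForm I M) :=
  isSmooth_liouvilleForm.pullback contMDiff_metricFlat

theorem tangentSymplecticForm_eq :
    tangentSymplecticForm I M = -MForm.extDeriv I.tangent (metricForm I M) := by
  unfold metricForm
  rw [isSmooth_liouvilleForm.extDeriv_pullback contMDiff_metricFlat]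
  rfl

end

/-! ### Nondegeneracy -/

section

variable {E : Type*} [NormedAddCommGroup E] [NormedSpace ℝ E]

/-- The exterior derivative of the 1-form `(q, a) ↦ B_q(a, dq)` is nondegenerate if `B` is. -/
theorem extDeriv_nondegenerate_of_bilinear {θ : E × E → (E × E) [⋀^Fin 1]→L[ℝ] ℝ}
    {B : E → E →L[ℝ] E →L[ℝ] ℝ} {y : E × E} (hθ : DifferentiableAt ℝ θ y)
    (hB : ∀ᶠ z in nhds y, ∀ u, θ z u = B z.1 z.2 (u 0).1)
    (h1 : ∀ a, (∀ b, B y.1 a b = 0) → a = 0) (h2 : ∀ b, (∀ a, B y.1 a b = 0) → b = 0)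
    {u : E × E} (hu : ∀ v, extDeriv θ y ![u, v] = 0) : u = 0 := by
  have hd : ∀ v : Fin 1 → E × E, DifferentiableAt ℝ (fun z => θ z v) y := fun v =>
    ((ContinuousMultilinearMap.apply ℝ (fun _ : Fin 1 => E × E) ℝ v).comp
      (ContinuousAlternatingMap.toContinuousMultilinearMapCLM ℝ)).differentiableAt.comp y hθ
  have key : ∀ v w : E × E, extDeriv θ y ![v, w] =
      fderiv ℝ (fun z => θ z ![w]) y v - fderiv ℝ (fun z => θ z ![v]) y w := by
    intro v w
    rw [extDeriv_apply hθ, Fin.sum_univ_two]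
    have e0 : (0 : Fin 2).removeNth ![v, w] = ![w] := by
      ext i <;> fin_cases i <;> rfl
    have e1 : (1 : Fin 2).removeNth ![v, w] = ![v] := by
      ext i <;> fin_cases i <;> rfl
    rw [e0, e1]
    simp [sub_eq_add_neg]
  have hvert : ∀ a : E, fderiv ℝ (fun z => θ z ![((0 : E), a)]) y = 0 := by
    intro a
    have : (fun z => θ z ![((0 : E), a)]) =ᶠ[nhds y] fun _ => (0 : ℝ) := by
      filter_upwards [hB] with z hz
      simp [hz]
    rw [this.fderiv_eq]
    simp
  have hfib : ∀ v : Fin 1 → E × E, ∀ a : E,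
      fderiv ℝ (fun z => θ z v) y (0, a) = B y.1 a (v 0).1 := by
    intro v a
    have hl : HasDerivAt (fun t : ℝ => y + t • ((0 : E), a)) ((0 : E), a) 0 := by
      simpa using ((hasDerivAt_id (0 : ℝ)).smul_const ((0 : E), a)).const_add y
    have hc := HasFDerivAt.comp_hasDerivAt_of_eq (0 : ℝ) (hd v).hasFDerivAt hl (by simp)
    have he : (fun z => θ z v) ∘ (fun t : ℝ => y + t • ((0 : E), a)) =ᶠ[nhds 0]
        fun t => B y.1 y.2 (v 0).1 + t * B y.1 a (v 0).1 := by
      have ht : Filter.Tendsto (fun t : ℝ => y + t • ((0 : E), a)) (nhds 0) (nhds y) := by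
        simpa using hl.continuousAt.tendsto
      filter_upwards [ht.eventually hB] with t ht
      rw [Function.comp_apply, ht v]
      simp
    have hr : HasDerivAt (fun t : ℝ => B y.1 y.2 (v 0).1 + t * B y.1 a (v 0).1)
        (B y.1 a (v 0).1) 0 := by
      simpa using ((hasDerivAt_id (0 : ℝ)).mul_const (B y.1 a (v 0).1)).const_add
        (B y.1 y.2 (v 0).1)
    exact hc.unique (hr.congr_of_eventuallyEq he)
  obtain ⟨x, b⟩ := u
  have hx : x = 0 := by
    refine h2 x fun a => ?_
    have := hu (0, a)
    rw [key, hvert, hfib] at this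
    simpa using this
  subst hx
  have hb : b = 0 := by
    refine h1 b fun x' => ?_
    have := hu (x', 0)
    rw [key, hvert, hfib] at this
    simpa using this
  rw [hb]
  rfl

variable [FiniteDimensional ℝ E]
  {H : Type*} [TopologicalSpace H] {I : ModelWithCorners ℝ E H} [I.Boundaryless]
  {M : Type*} [TopologicalSpace M] [ChartedSpace H M] [IsManifold I ∞ M]
  [Bundle.RiemannianBundle (fun x : M => TangentSpace I x)]
  [IsContMDiffRiemannianBundle I ∞ E (fun x : M => TangentSpace I x)]

theorem extDeriv_metricForm_nondegenerate (v : TangentBundle I M) (u : TangentSpace I.tangent v)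
    (hu : ∀ w : TangentSpace I.tangent v,
      MForm.extDeriv I.tangent (metricForm I M) v ![u, w] = 0) : u = 0 := by
  have hinv := isInvertible_mfderiv_extChartAt (I := I.tangent) (mem_extChartAt_source v)
  have hcs : ∀ z ∈ (extChartAt I.tangent v).target, z.1 ∈ (extChartAt I v.1).target ∧
      (extChartAt I v.1).symm z.1 ∈ (chartAt H v.1).source := by
    intro z hz
    erw [FiberBundle.extChartAt_target] at hz
    exact hz.1
  let S : ∀ q : E, E →L[ℝ] TangentSpace I ((extChartAt I v.1).symm q) := fun q =>
    (trivializationAt E (TangentSpace I) v.1).symmL ℝ ((extChartAt I v.1).symm q)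
  have hc : ∀ z ∈ (extChartAt I.tangent v).target, (extChartAt I.tangent v).symm z =
      ⟨(extChartAt I v.1).symm z.1, S z.1 z.2⟩ := by
    intro z hz
    have hz2 := (hcs z hz).2
    have hb : (extChartAt I v.1).symm z.1 ∈ (trivializationAt E (TangentSpace I) v.1).baseSet := hz2
    have h1 := Bundle.Trivialization.mk_symm (trivializationAt E (TangentSpace I) v.1) hb z.2
    have h2 : (extChartAt I.tangent v).symm z =
        (trivializationAt E (TangentSpace I) v.1).toOpenPartialHomeomorph.symm
          ((extChartAt I v.1).symm z.1, z.2) := by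
      erw [FiberBundle.extChartAt]
      rfl
    rw [h2, ← h1, ← Bundle.Trivialization.symmL_apply (R := ℝ) _ hb]
  have hS : ∀ z ∈ (extChartAt I.tangent v).target, ∀ w : E × E,
      mfderiv 𝓘(ℝ, E × E) I (fun y => ((extChartAt I.tangent v).symm y).1) z w = S z.1 w.1 := by
    intro z hz w
    have hz1 := (hcs z hz).1
    have he : (fun y => ((extChartAt I.tangent v).symm y).1) =ᶠ[nhds z]
        (extChartAt I v.1).symm ∘ Prod.fst := by
      filter_upwards [(isOpen_extChartAt_target v).mem_nhds hz] with y hy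
      rw [hc y hy]
      rfl
    have hd : mfderiv 𝓘(ℝ, E × E) I ((extChartAt I v.1).symm ∘ Prod.fst) z =
        (mfderiv 𝓘(ℝ, E) I (extChartAt I v.1).symm z.1).comp
          (mfderiv 𝓘(ℝ, E × E) 𝓘(ℝ, E) Prod.fst z) :=
      mfderiv_comp z ((MForm.contMDiffAt_extChartAt_symm v.1 hz1).mdifferentiableAt (by simp))
        (differentiableAt_fst.mdifferentiableAt)
    have hS' : S z.1 = mfderiv 𝓘(ℝ, E) I (extChartAt I v.1).symm z.1 := by
      have := TangentBundle.symmL_trivializationAt (𝕜 := ℝ) (I := I) (hcs z hz).2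
      rw [I.range_eq_univ, mfderivWithin_univ, (extChartAt I v.1).right_inv hz1] at this
      exact this
    rw [he.mfderiv_eq, hd, hS', mfderiv_eq_fderiv, fderiv_fst]
    rfl
  let B : E → E →L[ℝ] E →L[ℝ] ℝ := fun q =>
    (innerSL ℝ (E := TangentSpace I ((extChartAt I v.1).symm q))).bilinearComp (S q) (S q)
  have hBS : ∀ q a b, B q a b = inner ℝ (S q a) (S q b) := fun _ _ _ => rfl
  have hfib : ∀ (w w' : TangentBundle I M), w = w' → ∀ a : E,
      inner ℝ w.2 (a : TangentSpace I w.1) = inner ℝ w'.2 (a : TangentSpace I w'.1) := by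
    rintro w _ rfl a
    rfl
  have hinj : ∀ a, (∀ b, B (extChartAt I.tangent v v).1 a b = 0) → a = 0 := by
    intro a ha
    have h0 : S (extChartAt I.tangent v v).1 a = 0 := inner_self_eq_zero.1 (ha a)
    have hb := (hcs _ (mem_extChartAt_target v)).2
    have := Bundle.Trivialization.continuousLinearMapAt_symmL
      (trivializationAt E (TangentSpace I) v.1) (R := ℝ) (b := (extChartAt I v.1).symm
        (extChartAt I.tangent v v).1) hb a
    rw [← this]
    exact (congrArg _ h0).trans (map_zero _)
  have hzero := extDeriv_nondegenerate_of_bilinear (B := B)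
    (θ := (metricForm I M).onSpace (extChartAt I.tangent v).symm)
    (y := extChartAt I.tangent v v)
    (u := mfderiv I.tangent 𝓘(ℝ, E × E) (extChartAt I.tangent v) v u)
    ?_ ?_ hinj ?_ ?_
  · exact hinv.injective (hzero.trans (map_zero _).symm)
  · exact (isSmooth_metricForm.contDiffAt_onSpace (MForm.contMDiffAt_extChartAt_symm v
      (mem_extChartAt_target v))).differentiableAt (by simp)
  · filter_upwards [extChartAt_target_mem_nhds (I := I.tangent) v] with z hz w
    refine (metricForm_apply ((extChartAt I.tangent v).symm z) (fun i =>
      mfderiv 𝓘(ℝ, E × E) I.tangent (extChartAt I.tangent v).symm z (w i))).trans ?_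
    have hd : mfderiv 𝓘(ℝ, E × E) I (fun y => ((extChartAt I.tangent v).symm y).1) z =
        (mfderiv I.tangent I (Bundle.TotalSpace.proj : TangentBundle I M → M)
          ((extChartAt I.tangent v).symm z)).comp
        (mfderiv 𝓘(ℝ, E × E) I.tangent (extChartAt I.tangent v).symm z) :=
      mfderiv_comp (g := (Bundle.TotalSpace.proj : TangentBundle I M → M)) z
        ((Bundle.contMDiff_proj (n := 1) _).mdifferentiable (by simp) _)
        ((MForm.contMDiffAt_extChartAt_symm v hz).mdifferentiableAt (by simp))
    have hz' := hS z hz (w 0)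
    rw [hd] at hz'
    exact (hfib _ _ (hc z hz) _).trans (congrArg _ hz')
  · intro b hb
    refine hinj b fun a => ?_
    rw [← hb a, hBS, hBS]
    exact real_inner_comm _ _
  · intro w
    obtain ⟨w', rfl⟩ := hinv.surjective w
    have := hu w'
    rw [MForm.extDeriv_eq_onSpace] at this
    rw [← this]
    refine congrArg _ ?_
    ext i <;> fin_cases i <;> rfl

variable (I M) in
/-- The canonical 2-form on the tangent bundle of a Riemannian manifold is symplectic. -/
theorem isSymplectic_tangentSymplecticForm :
    MForm.IsSymplectic I.tangent (tangentSymplecticForm I M) where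
  smooth := by
    rw [tangentSymplecticForm_eq]
    exact isSmooth_metricForm.extDeriv.neg
  closed := by
    rw [tangentSymplecticForm_eq, MForm.extDeriv_neg, isSmooth_metricForm.extDeriv_extDeriv]
    exact neg_zero
  nondegenerate v u hu := by
    refine extDeriv_metricForm_nondegenerate v u fun w => ?_
    have := hu w
    rw [tangentSymplecticForm_eq] at this
    exact neg_eq_zero.1 this

end

/-! ### Invariant 1-forms -/

section

variable {E : Type*} [NormedAddCommGroup E] [NormedSpace ℝ E]
  {H : Type*} [TopologicalSpace H] {I : ModelWithCorners ℝ E H}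
  {M : Type*} [TopologicalSpace M] [ChartedSpace H M]
  {E' : Type*} [NormedAddCommGroup E'] [NormedSpace ℝ E']
  {H' : Type*} [TopologicalSpace H'] {I' : ModelWithCorners ℝ E' H'}
  {M' : Type*} [TopologicalSpace M'] [ChartedSpace H' M']

theorem mfderiv_apply_congr_point (f : M → M') {x y : M} (h : x = y) (u : E) :
    (mfderiv I I' f x u : E') = mfderiv I I' f y u := by
  subst h
  rfl

theorem MForm.apply_congr_point {n : ℕ} (η : MForm I M n) {x y : M} (h : x = y) (v : Fin n → E) :
    η x (v : Fin n → TangentSpace I x) = η y (v : Fin n → TangentSpace I y) := by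
  subst h
  rfl

theorem TangentBundle.mk_congr_point {x y : M} (h : x = y) (u : E) :
    (⟨x, u⟩ : TangentBundle I M) = ⟨y, u⟩ := by
  subst h
  rfl

/-- Every tangent vector is the velocity of a smooth curve. -/
theorem exists_curve_mfderiv_eq [FiniteDimensional ℝ E] [I.Boundaryless] [IsManifold I ∞ M]
    (x : M) (w : E) :
    ∃ γ : ℝ → M, γ 0 = x ∧ ContMDiffAt 𝓘(ℝ, ℝ) I ∞ γ 0 ∧
      (mfderiv 𝓘(ℝ, ℝ) I γ 0 (1 : ℝ) : E) = w := by
  have hd : MDifferentiableAt 𝓘(ℝ, E) I (extChartAt I x).symm (extChartAt I x x) :=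
    (MForm.contMDiffAt_extChartAt_symm x (mem_extChartAt_target x)).mdifferentiableAt (by simp)
  have hd' : MDifferentiableAt I 𝓘(ℝ, E) (extChartAt I x) x :=
    (contMDiffAt_extChartAt (n := 1)).mdifferentiableAt (by simp)
  let w' : E := mfderiv I 𝓘(ℝ, E) (extChartAt I x) x w
  have h0 : extChartAt I x x + (0 : ℝ) • w' = extChartAt I x x := by simp
  have hl : HasDerivAt (fun t : ℝ => extChartAt I x x + t • w') w' 0 := by
    simpa using ((hasDerivAt_id (0 : ℝ)).smul_const w').const_add (extChartAt I x x)
  have hls : ContDiff ℝ ∞ (fun t : ℝ => extChartAt I x x + t • w') := by fun_prop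
  refine ⟨fun t => (extChartAt I x).symm (extChartAt I x x + t • w'), by simp, ?_, ?_⟩
  · exact ContMDiffAt.comp (g := (extChartAt I x).symm) (0 : ℝ)
      (MForm.contMDiffAt_extChartAt_symm x (by rw [h0]; exact mem_extChartAt_target x))
      hls.contMDiff.contMDiffAt
  · have e1 := mfderiv_comp (I := 𝓘(ℝ, ℝ)) (I' := 𝓘(ℝ, E)) (I'' := I)
      (g := (extChartAt I x).symm) (f := fun t : ℝ => extChartAt I x x + t • w') (0 : ℝ)
      (by rw [h0]; exact hd) hl.differentiableAt.mdifferentiableAt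
    have e2 : mfderiv 𝓘(ℝ, ℝ) 𝓘(ℝ, E) (fun t : ℝ => extChartAt I x x + t • w') 0 (1 : ℝ) = w' := by
      rw [mfderiv_eq_fderiv]
      exact (congrArg (fun A : ℝ →L[ℝ] E => A 1) hl.hasFDerivAt.fderiv).trans (one_smul ℝ w')
    have e3 : (extChartAt I x).symm ∘ extChartAt I x =ᶠ[nhds x] id := by
      filter_upwards [extChartAt_source_mem_nhds (I := I) x] with y hy
      exact (extChartAt I x).left_inv hy
    have e4 := mfderiv_comp (I := I) (I' := 𝓘(ℝ, E)) (I'' := I) x hd hd'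
    rw [e3.mfderiv_eq, mfderiv_id] at e4
    have e5 : (mfderiv 𝓘(ℝ, E) I (extChartAt I x).symm (extChartAt I x x) w' : E) = w :=
      (congrArg (fun A : E →L[ℝ] E => A w) e4).symm
    rw [← e5]
    refine (congrArg (fun A : ℝ →L[ℝ] E => A 1) e1).trans ?_
    refine (mfderiv_apply_congr_point (extChartAt I x).symm h0 _).trans ?_
    exact congrArg (fun u : E => (mfderiv 𝓘(ℝ, E) I (extChartAt I x).symm (extChartAt I x x) u : E))
      e2

theorem mfderiv_apply_fst {c : ℝ × ℝ → M} {s t : ℝ}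
    (hc : MDifferentiableAt 𝓘(ℝ, ℝ × ℝ) I c (s, t)) :
    (mfderiv 𝓘(ℝ, ℝ × ℝ) I c (s, t) ((1, 0) : ℝ × ℝ) : E) =
      mfderiv 𝓘(ℝ, ℝ) I (fun r => c (r, t)) s (1 : ℝ) := by
  have hl : HasFDerivAt (fun r : ℝ => (r, t)) ((ContinuousLinearMap.id ℝ ℝ).prod 0) s :=
    (hasFDerivAt_id s).prodMk (hasFDerivAt_const t s)
  have := mfderiv_comp (I := 𝓘(ℝ, ℝ)) (I' := 𝓘(ℝ, ℝ × ℝ)) (I'' := I) (g := c) s hc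
    hl.differentiableAt.mdifferentiableAt
  rw [mfderiv_eq_fderiv, hl.fderiv] at this
  exact (congrArg (fun A : ℝ →L[ℝ] E => A 1) this).symm

theorem mfderiv_apply_snd {c : ℝ × ℝ → M} {s t : ℝ}
    (hc : MDifferentiableAt 𝓘(ℝ, ℝ × ℝ) I c (s, t)) :
    (mfderiv 𝓘(ℝ, ℝ × ℝ) I c (s, t) ((0, 1) : ℝ × ℝ) : E) =
      mfderiv 𝓘(ℝ, ℝ) I (fun r => c (s, r)) t (1 : ℝ) := by
  have hl : HasFDerivAt (fun r : ℝ => (s, r))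
      ((0 : ℝ →L[ℝ] ℝ).prod (ContinuousLinearMap.id ℝ ℝ)) t :=
    (hasFDerivAt_const s t).prodMk (hasFDerivAt_id t)
  have := mfderiv_comp (I := 𝓘(ℝ, ℝ)) (I' := 𝓘(ℝ, ℝ × ℝ)) (I'' := I) (g := c) t hc
    hl.differentiableAt.mdifferentiableAt
  rw [mfderiv_eq_fderiv, hl.fderiv] at this
  exact (congrArg (fun A : ℝ →L[ℝ] E => A 1) this).symm

end

section

variable {EG : Type*} [NormedAddCommGroup EG] [NormedSpace ℝ EG] [FiniteDimensional ℝ EG]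
  {HG : Type*} [TopologicalSpace HG] {IG : ModelWithCorners ℝ EG HG} [IG.Boundaryless]
  {G : Type*} [TopologicalSpace G] [ChartedSpace HG G] [Group G] [IsManifold IG ∞ G]
  {E : Type*} [NormedAddCommGroup E] [NormedSpace ℝ E] [FiniteDimensional ℝ E]
  {H : Type*} [TopologicalSpace H] {I : ModelWithCorners ℝ E H} [I.Boundaryless]
  {M : Type*} [TopologicalSpace M] [ChartedSpace H M] [IsManifold I ∞ M]
  [MulAction G M] [ContMDiffSMul IG I ∞ G M]

theorem mdifferentiable_const_smul (IG : ModelWithCorners ℝ EG HG) [ContMDiffSMul IG I ∞ G M]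
    (g : G) : MDifferentiable I I (fun x : M => g • x) :=
  (ContMDiffSMul.contMDiff_const_smul (I := IG) (n := ∞) g).mdifferentiable (by simp)

theorem mdifferentiable_smul_const (x : M) : MDifferentiable IG I (fun g : G => g • x) :=
  ((contMDiff_smul (I := IG) (I' := I) (n := ∞) (G := G) (M := M)).comp
    (contMDiff_id.prodMk contMDiff_const)).mdifferentiable (by simp)

theorem mfderiv_one_smul (x : M) (w : E) :
    (mfderiv I I (fun y : M => (1 : G) • y) x w : E) = w := by
  have : (fun y : M => (1 : G) • y) = id := funext fun y => one_smul G y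
  rw [this, mfderiv_id]
  rfl

/-- Cartan's formula for an invariant 1-form `η` and a vector field generated by the group:
the differential of `η(ξ_M)` is `-dη(ξ_M, ·)`. -/
theorem mfderiv_apply_infinitesimalAction_of_invariant {η : MForm I M 1} (hη : MForm.IsSmooth I η)
    (hinv : ∀ g : G, MForm.pullback I I (fun x : M => g • x) η = η) (ξ : EG) (x : M)
    (w : TangentSpace I x)
    (hd : MDifferentiableAt I 𝓘(ℝ, ℝ)
      (fun y => η y ![infinitesimalAction IG G I y ξ]) x) :
    mfderiv I 𝓘(ℝ, ℝ) (fun y => η y ![infinitesimalAction IG G I y ξ]) x w =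
      -MForm.extDeriv I η x ![infinitesimalAction IG G I x ξ, w] := by
  obtain ⟨a, ha0, ha, had⟩ := exists_curve_mfderiv_eq (I := IG) (1 : G) ξ
  obtain ⟨b, hb0, hb, hbd⟩ := exists_curve_mfderiv_eq (I := I) x w
  let c : ℝ × ℝ → M := fun r => a r.1 • b r.2
  have hc : ContMDiffAt 𝓘(ℝ, ℝ × ℝ) I ∞ c (0, 0) := by
    have h1 : ContMDiffAt 𝓘(ℝ, ℝ × ℝ) IG ∞ (fun r : ℝ × ℝ => a r.1) (0, 0) :=
      ContMDiffAt.comp (g := a) ((0, 0) : ℝ × ℝ) ha contDiff_fst.contMDiff.contMDiffAt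
    have h2 : ContMDiffAt 𝓘(ℝ, ℝ × ℝ) I ∞ (fun r : ℝ × ℝ => b r.2) (0, 0) :=
      ContMDiffAt.comp (g := b) ((0, 0) : ℝ × ℝ) hb contDiff_snd.contMDiff.contMDiffAt
    exact h1.smul h2
  have hc1 : ∀ᶠ t in nhds (0 : ℝ), MDifferentiableAt 𝓘(ℝ, ℝ × ℝ) I c (0, t) :=
    (Continuous.tendsto (by fun_prop : Continuous fun t : ℝ => ((0, t) : ℝ × ℝ)) 0).eventually
      (MForm.eventually_mdifferentiableAt hc)
  have hc2 : ∀ᶠ s in nhds (0 : ℝ), MDifferentiableAt 𝓘(ℝ, ℝ × ℝ) I c (s, 0) :=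
    (Continuous.tendsto (by fun_prop : Continuous fun s : ℝ => ((s, 0) : ℝ × ℝ)) 0).eventually
      (MForm.eventually_mdifferentiableAt hc)
  have hc00 : c (0, 0) = x := by simp [c, ha0, hb0]
  have d1 : ∀ t, MDifferentiableAt 𝓘(ℝ, ℝ × ℝ) I c (0, t) →
      (mfderiv 𝓘(ℝ, ℝ × ℝ) I c (0, t) ((1, 0) : ℝ × ℝ) : E) =
        infinitesimalAction IG G I (b t) ξ := by
    intro t ht
    rw [mfderiv_apply_fst ht]
    have e := mfderiv_comp (I := 𝓘(ℝ, ℝ)) (I' := IG) (I'' := I) (g := fun g : G => g • b t)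
      (f := a) (0 : ℝ) (mdifferentiable_smul_const (b t) _)
      (ha.mdifferentiableAt (by simp))
    refine (congrArg (fun A : ℝ →L[ℝ] E => A 1) e).trans ?_
    refine (mfderiv_apply_congr_point (fun g : G => g • b t) ha0 _).trans ?_
    exact congrArg (fun u : EG => (mfderiv IG I (fun g : G => g • b t) 1 u : E)) had
  have d2 : ∀ s, MDifferentiableAt 𝓘(ℝ, ℝ × ℝ) I c (s, 0) →
      (mfderiv 𝓘(ℝ, ℝ × ℝ) I c (s, 0) ((0, 1) : ℝ × ℝ) : E) =
        mfderiv I I (fun y : M => a s • y) (b 0) (mfderiv 𝓘(ℝ, ℝ) I b 0 (1 : ℝ)) := by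
    intro s hs
    rw [mfderiv_apply_snd hs]
    have e := mfderiv_comp (I := 𝓘(ℝ, ℝ)) (I' := I) (I'' := I) (g := fun y : M => a s • y)
      (f := b) (0 : ℝ) (mdifferentiable_const_smul IG (a s) _)
      (hb.mdifferentiableAt (by simp))
    exact congrArg (fun A : ℝ →L[ℝ] E => A 1) e
  have hθ : DifferentiableAt ℝ (η.onSpace c) (0, 0) :=
    (hη.contDiffAt_onSpace hc).differentiableAt (by simp)
  have hθv : ∀ v : Fin 1 → ℝ × ℝ, DifferentiableAt ℝ (fun z => η.onSpace c z v) (0, 0) := fun v =>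
    ((ContinuousMultilinearMap.apply ℝ (fun _ : Fin 1 => ℝ × ℝ) ℝ v).comp
      (ContinuousAlternatingMap.toContinuousMultilinearMapCLM ℝ)).differentiableAt.comp _ hθ
  have key : extDeriv (η.onSpace c) (0, 0) ![(1, 0), (0, 1)] =
      fderiv ℝ (fun z => η.onSpace c z ![(0, 1)]) (0, 0) (1, 0) -
        fderiv ℝ (fun z => η.onSpace c z ![(1, 0)]) (0, 0) (0, 1) := by
    rw [extDeriv_apply hθ, Fin.sum_univ_two]
    have e0 : (0 : Fin 2).removeNth ![((1 : ℝ), (0 : ℝ)), (0, 1)] = ![(0, 1)] := by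
      ext i <;> fin_cases i <;> rfl
    have e1 : (1 : Fin 2).removeNth ![((1 : ℝ), (0 : ℝ)), (0, 1)] = ![(1, 0)] := by
      ext i <;> fin_cases i <;> rfl
    rw [e0, e1]
    simp [sub_eq_add_neg]
  have k1 : fderiv ℝ (fun z => η.onSpace c z ![(0, 1)]) (0, 0) (1, 0) = 0 := by
    have hl : HasDerivAt (fun s : ℝ => (s, (0 : ℝ))) (1, 0) 0 :=
      (hasDerivAt_id (0 : ℝ)).prodMk (hasDerivAt_const _ _)
    have hcomp := HasFDerivAt.comp_hasDerivAt_of_eq (0 : ℝ) (hθv ![(0, 1)]).hasFDerivAt hl rfl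
    have he : (fun z => η.onSpace c z ![(0, 1)]) ∘ (fun s : ℝ => (s, (0 : ℝ))) =ᶠ[nhds 0]
        fun _ => η (b 0) ![mfderiv 𝓘(ℝ, ℝ) I b 0 (1 : ℝ)] := by
      filter_upwards [hc2] with s hs
      refine Eq.trans (congrArg (η (a s • b 0)) (funext fun i => ?_))
        (DFunLike.congr_fun (congrFun (hinv (a s)) (b 0)) ![mfderiv 𝓘(ℝ, ℝ) I b 0 (1 : ℝ)])
      fin_cases i
      exact d2 s hs
    exact hcomp.unique ((hasDerivAt_const _ _).congr_of_eventuallyEq he)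
  have k2 : fderiv ℝ (fun z => η.onSpace c z ![(1, 0)]) (0, 0) (0, 1) =
      (mfderiv I 𝓘(ℝ, ℝ) (fun y => η y ![infinitesimalAction IG G I y ξ]) x w : ℝ) := by
    have hl : HasDerivAt (fun s : ℝ => ((0 : ℝ), s)) (0, 1) 0 :=
      (hasDerivAt_const _ _).prodMk (hasDerivAt_id (0 : ℝ))
    have hcomp := HasFDerivAt.comp_hasDerivAt_of_eq (0 : ℝ) (hθv ![(1, 0)]).hasFDerivAt hl rfl
    have he : (fun z => η.onSpace c z ![(1, 0)]) ∘ (fun s : ℝ => ((0 : ℝ), s)) =ᶠ[nhds 0]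
        (fun y => η y ![infinitesimalAction IG G I y ξ]) ∘ b := by
      filter_upwards [hc1] with t ht
      have h0 : c (0, t) = b t := by simp [c, ha0]
      refine Eq.trans ?_ (η.apply_congr_point h0 _)
      refine congrArg (η (c (0, t))) (funext fun i => ?_)
      fin_cases i
      exact d1 t ht
    have e := mfderiv_comp_of_eq (I := 𝓘(ℝ, ℝ)) (I' := I) (I'' := 𝓘(ℝ, ℝ))
      (g := fun y => η y ![infinitesimalAction IG G I y ξ]) (f := b) (x := (0 : ℝ)) (y := x) hd
      (hb.mdifferentiableAt (by simp)) hb0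
    rw [← he.mfderiv_eq, mfderiv_eq_fderiv] at e
    have e1 := (congrArg (fun A : ℝ →L[ℝ] ℝ => A 1) hcomp.hasFDerivAt.fderiv).trans
      (one_smul ℝ _)
    have e2 := congrArg (fun A : ℝ →L[ℝ] ℝ => A 1) e
    refine e1.symm.trans (e2.trans ?_)
    exact (mfderiv_apply_congr_point (fun y => η y ![infinitesimalAction IG G I y ξ]) hb0 _).trans
      (congrArg (fun u : E => (mfderiv I 𝓘(ℝ, ℝ)
        (fun y => η y ![infinitesimalAction IG G I y ξ]) x u : ℝ)) hbd)
  have k3 : extDeriv (η.onSpace c) (0, 0) ![(1, 0), (0, 1)] =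
      MForm.extDeriv I η x ![infinitesimalAction IG G I x ξ, w] := by
    rw [hη.extDeriv_onSpace hc]
    refine Eq.trans ?_ ((MForm.extDeriv I η).apply_congr_point hc00 _)
    refine congrArg (MForm.extDeriv I η (c (0, 0))) (funext fun i => ?_)
    fin_cases i
    · refine (d1 0 hc1.self_of_nhds).trans ?_
      rw [hb0]
      rfl
    · refine (d2 0 hc2.self_of_nhds).trans ?_
      rw [ha0]
      exact (mfderiv_one_smul _ _).trans hbd
  rw [k1, k3, k2] at key
  rw [key]
  exact (by intro r; ring : ∀ r : ℝ, r = -(0 - r)) _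

end

/-! ### The action by derivatives -/

section

variable {EG : Type*} [NormedAddCommGroup EG] [NormedSpace ℝ EG] [FiniteDimensional ℝ EG]
  {HG : Type*} [TopologicalSpace HG] {IG : ModelWithCorners ℝ EG HG} [IG.Boundaryless]
  {G : Type*} [TopologicalSpace G] [ChartedSpace HG G] [Group G]
  {E : Type*} [NormedAddCommGroup E] [NormedSpace ℝ E] [FiniteDimensional ℝ E]
  {H : Type*} [TopologicalSpace H] {I : ModelWithCorners ℝ E H} [I.Boundaryless]
  {M : Type*} [TopologicalSpace M] [ChartedSpace H M] [IsManifold I ∞ M]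
  [MulAction G M]

theorem mfderiv_smul_prod_right [ContMDiffSMul IG I ∞ G M] (g : G) (p : M) (w : E) :
    (mfderiv (IG.prod I) I (fun r : G × M => r.1 • r.2) (g, p) ((0, w) : EG × E) : E) =
      mfderiv I I (fun x : M => g • x) p w := by
  have h := mfderiv_comp (I := I) (I' := IG.prod I) (I'' := I)
    (g := fun r : G × M => r.1 • r.2) (f := fun x : M => (g, x)) p
    ((contMDiff_smul (I := IG) (I' := I) (n := ∞)).mdifferentiable (by simp) _)
    ((contMDiff_const.prodMk contMDiff_id).mdifferentiable (n := 1) (by simp) p)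
  rw [mfderiv_prod_right] at h
  exact (congrArg (fun A : E →L[ℝ] E => A w) h).symm

theorem mfderiv_smul_prod_left [ContMDiffSMul IG I ∞ G M] (g : G) (p : M) (ξ : EG) :
    (mfderiv (IG.prod I) I (fun r : G × M => r.1 • r.2) (g, p) ((ξ, 0) : EG × E) : E) =
      mfderiv IG I (fun h : G => h • p) g ξ := by
  have h := mfderiv_comp (I := IG) (I' := IG.prod I) (I'' := I)
    (g := fun r : G × M => r.1 • r.2) (f := fun h : G => (h, p)) g
    ((contMDiff_smul (I := IG) (I' := I) (n := ∞)).mdifferentiable (by simp) _)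
    ((contMDiff_id.prodMk contMDiff_const).mdifferentiable (n := 1) (by simp) g)
  rw [mfderiv_prod_left] at h
  exact (congrArg (fun A : EG →L[ℝ] E => A ξ) h).symm

variable [LieGroup IG ∞ G]

theorem contMDiffSMul_tangentAction [ContMDiffSMul IG I ∞ G M] :
    letI : MulAction G (TangentBundle I M) := tangentAction IG G I M
    ContMDiffSMul IG I.tangent ∞ G (TangentBundle I M) := by
  letI : MulAction G (TangentBundle I M) := tangentAction IG G I M
  refine ⟨?_⟩
  have h1 : ContMDiff (IG.prod I).tangent I.tangent ∞
      (tangentMap (IG.prod I) I (fun r : G × M => r.1 • r.2)) :=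
    (contMDiff_smul (I := IG) (I' := I) (n := ∞)).contMDiff_tangentMap (by simp)
  have h2 : ContMDiff (IG.prod I.tangent) (IG.tangent.prod I.tangent) ∞
      (fun r : G × TangentBundle I M => ((⟨r.1, 0⟩ : TangentBundle IG G), r.2)) :=
    ((Bundle.contMDiff_zeroSection ℝ (TangentSpace IG : G → Type _)).comp contMDiff_fst).prodMk
      contMDiff_snd
  refine ((h1.comp (contMDiff_equivTangentBundleProd_symm)).comp h2).congr fun r => ?_
  exact congrArg (fun u : E => (⟨r.1 • r.2.1, u⟩ : TangentBundle I M)) (mfderiv_smul_prod_right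
    (IG := IG) (E := E) (I := I) r.1 r.2.1 r.2.2).symm

theorem contMDiff_infinitesimalAction [ContMDiffSMul IG I ∞ G M] (ξ : EG) :
    ContMDiff I I.tangent ∞
      (fun p : M => (⟨p, infinitesimalAction IG G I p ξ⟩ : TangentBundle I M)) := by
  have h1 : ContMDiff (IG.prod I).tangent I.tangent ∞
      (tangentMap (IG.prod I) I (fun r : G × M => r.1 • r.2)) :=
    (contMDiff_smul (I := IG) (I' := I) (n := ∞)).contMDiff_tangentMap (by simp)
  have h2 : ContMDiff I (IG.tangent.prod I.tangent) ∞
      (fun p : M => ((⟨1, ξ⟩ : TangentBundle IG G), (⟨p, 0⟩ : TangentBundle I M))) :=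
    contMDiff_const.prodMk (Bundle.contMDiff_zeroSection ℝ (TangentSpace I : M → Type _))
  refine ((h1.comp (contMDiff_equivTangentBundleProd_symm)).comp h2).congr fun p => ?_
  refine (TangentBundle.mk_congr_point (one_smul G p).symm _).trans ?_
  exact congrArg (fun u : E => (⟨(1 : G) • p, u⟩ : TangentBundle I M))
    (mfderiv_smul_prod_left 1 p ξ).symm

variable [Bundle.RiemannianBundle (fun x : M => TangentSpace I x)]

theorem tangentMomentMap_apply (v : TangentBundle I M) (ξ : EG) :
    tangentMomentMap IG G I M v ξ = inner ℝ v.2 (infinitesimalAction IG G I v.1 ξ) := rfl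

variable [IsContMDiffRiemannianBundle I ∞ E (fun x : M => TangentSpace I x)]

theorem contMDiff_tangentMomentMap [ContMDiffSMul IG I ∞ G M] :
    ContMDiff I.tangent 𝓘(ℝ, EG →L[ℝ] ℝ) ∞ (tangentMomentMap IG G I M) := by
  intro v
  refine contMDiffAt_clm_of_apply fun ξ => ?_
  have h1 : ContMDiff I.tangent I.tangent ∞ (fun v : TangentBundle I M =>
      (⟨v.1, infinitesimalAction IG G I v.1 ξ⟩ : TangentBundle I M)) :=
    (contMDiff_infinitesimalAction (IG := IG) (G := G) ξ).comp (Bundle.contMDiff_proj _)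
  exact ContMDiffAt.inner_bundle (F := E) (E := fun x : M => TangentSpace I x)
    (b := fun v : TangentBundle I M => v.1) (v := fun v => v.2)
    (w := fun v => infinitesimalAction IG G I v.1 ξ) contMDiffAt_id h1.contMDiffAt

section

variable [ContMDiffSMul IG I ∞ G M]
  (isometric : ∀ (g : G) (p : M) (v w : TangentSpace I p),
    inner ℝ (mfderiv I I (fun x : M => g • x) p v) (mfderiv I I (fun x : M => g • x) p w) =
      inner ℝ v w)

include isometric in
theorem pullback_smul_metricForm (g : G) :
    letI : MulAction G (TangentBundle I M) := tangentAction IG G I M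
    MForm.pullback I.tangent I.tangent (fun v : TangentBundle I M => g • v) (metricForm I M) =
      metricForm I M := by
  let _ : MulAction G (TangentBundle I M) := tangentAction IG G I M
  have := contMDiffSMul_tangentAction (IG := IG) (G := G) (I := I) (M := M)
  funext v
  ext w
  rw [MForm.pullback_apply, metricForm_apply, metricForm_apply]
  refine Eq.trans ?_ (isometric g v.1 v.2 _)
  have e1 := mfderiv_comp (I := I.tangent) (I' := I.tangent) (I'' := I)
    (g := (Bundle.TotalSpace.proj : TangentBundle I M → M))
    (f := fun v : TangentBundle I M => g • v) v
    ((Bundle.contMDiff_proj (n := 1) _).mdifferentiable (by simp) _)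
    (mdifferentiable_const_smul IG g v)
  have e2 := mfderiv_comp (I := I.tangent) (I' := I) (I'' := I)
    (f := (Bundle.TotalSpace.proj : TangentBundle I M → M))
    (g := fun x : M => g • x) v
    (mdifferentiable_const_smul IG g _)
    ((Bundle.contMDiff_proj (n := 1) _).mdifferentiable (by simp) v)
  have e3 := congrArg (fun A : E × E →L[ℝ] E => A (w 0)) (e1.symm.trans e2)
  exact congrArg (fun u : E => @inner ℝ (TangentSpace I (g • v.1)) _
    (mfderiv I I (fun x : M => g • x) v.1 v.2) u) e3

theorem infinitesimalAction_smul (g : G) (p : M) (ξ : EG) :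
    (infinitesimalAction IG G I (g • p) ξ : E) =
      mfderiv I I (fun x : M => g • x) p (infinitesimalAction IG G I p (lieAd IG g⁻¹ ξ)) := by
  have hf : (fun h : G => h • g • p) =
      (fun x : M => g • x) ∘ (fun h : G => h • p) ∘ fun h : G => g⁻¹ * h * g⁻¹⁻¹ := by
    funext h
    simp [smul_smul, mul_assoc]
  have h1 : g⁻¹ * 1 * g⁻¹⁻¹ = 1 := by simp
  have hc : MDifferentiable IG IG (fun h : G => g⁻¹ * h * g⁻¹⁻¹) :=
    ((contMDiff_const.mul contMDiff_id).mul contMDiff_const : ContMDiff IG IG ∞ _).mdifferentiable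
      (by simp)
  have ho := mdifferentiable_smul_const (IG := IG) (G := G) (I := I) p
  have e1 := mfderiv_comp (I := IG) (I' := I) (I'' := I) (g := fun x : M => g • x)
    (f := (fun h : G => h • p) ∘ fun h : G => g⁻¹ * h * g⁻¹⁻¹) (1 : G)
    (mdifferentiable_const_smul IG g _) (ho.comp hc _)
  have e2 := mfderiv_comp (I := IG) (I' := IG) (I'' := I) (g := fun h : G => h • p)
    (f := fun h : G => g⁻¹ * h * g⁻¹⁻¹) (1 : G) (ho _) (hc _)
  rw [e2, ← hf] at e1
  refine (congrArg (fun A : EG →L[ℝ] E => A ξ) e1).trans ?_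
  refine (mfderiv_apply_congr_point (fun x : M => g • x)
    (show (g⁻¹ * 1 * g⁻¹⁻¹) • p = p by rw [h1, one_smul]) _).trans ?_
  exact congrArg (fun u : E => (mfderiv I I (fun x : M => g • x) p u : E))
    (mfderiv_apply_congr_point (fun h : G => h • p) h1 _)

theorem mfderiv_proj_infinitesimalAction (v : TangentBundle I M) (ξ : EG) :
    letI : MulAction G (TangentBundle I M) := tangentAction IG G I M
    mfderiv I.tangent I (Bundle.TotalSpace.proj : TangentBundle I M → M) v
      (infinitesimalAction IG G I.tangent v ξ) = infinitesimalAction IG G I v.1 ξ := by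
  let _ : MulAction G (TangentBundle I M) := tangentAction IG G I M
  have := contMDiffSMul_tangentAction (IG := IG) (G := G) (I := I) (M := M)
  have e := mfderiv_comp (I := IG) (I' := I.tangent) (I'' := I)
    (g := (Bundle.TotalSpace.proj : TangentBundle I M → M)) (f := fun g : G => g • v) 1
    ((Bundle.contMDiff_proj (n := 1) _).mdifferentiable (by simp) _)
    (mdifferentiable_smul_const v 1)
  refine Eq.trans ?_ (congrArg (fun A : EG →L[ℝ] E => A ξ) e).symm
  exact mfderiv_apply_congr_point (Bundle.TotalSpace.proj : TangentBundle I M → M)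
    (one_smul G v).symm _

theorem metricForm_infinitesimalAction (v : TangentBundle I M) (ξ : EG) :
    letI : MulAction G (TangentBundle I M) := tangentAction IG G I M
    metricForm I M v ![infinitesimalAction IG G I.tangent v ξ] = tangentMomentMap IG G I M v ξ := by
  letI : MulAction G (TangentBundle I M) := tangentAction IG G I M
  rw [metricForm_apply, tangentMomentMap_apply]
  exact congrArg (fun u : E => @inner ℝ (TangentSpace I v.1) _ v.2 u)
    (mfderiv_proj_infinitesimalAction v ξ)

include isometric in
theorem isHamiltonianAction_tangentAction :
    letI : MulAction G (TangentBundle I M) := tangentAction IG G I M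
    IsHamiltonianAction IG I.tangent G (tangentSymplecticForm I M)
        (tangentMomentMap IG G I M) := by
  let _ : MulAction G (TangentBundle I M) := tangentAction IG G I M
  have := contMDiffSMul_tangentAction (IG := IG) (G := G) (I := I) (M := M)
  have hs : ∀ g : G, ContMDiff I.tangent I.tangent ∞ (fun v : TangentBundle I M => g • v) :=
    fun g => ContMDiffSMul.contMDiff_const_smul (I := IG) (n := ∞) g
  exact {
    contMDiffSMul := this
    isSymplectic := isSymplectic_tangentSymplecticForm I M
    invariant := fun g => by
      rw [tangentSymplecticForm_eq, MForm.pullback_neg,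
        ← isSmooth_metricForm.extDeriv_pullback (hs g)]
      rw [pullback_smul_metricForm isometric]
    contMDiff := contMDiff_tangentMomentMap
    equivariant := fun g v ξ => by
      rw [tangentMomentMap_apply, tangentMomentMap_apply]
      refine Eq.trans ?_ (isometric g v.1 v.2 _)
      exact congrArg (fun u : E => @inner ℝ (TangentSpace I (g • v.1)) _
        (mfderiv I I (fun x : M => g • x) v.1 v.2) u)
        (infinitesimalAction_smul (IG := IG) g v.1 ξ)
    moment := fun ξ v w => by
      have he : (fun y => tangentMomentMap IG G I M y ξ) =
          fun y => metricForm I M y ![infinitesimalAction IG G I.tangent y ξ] :=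
        funext fun y => (metricForm_infinitesimalAction y ξ).symm
      have hd : MDifferentiableAt I.tangent 𝓘(ℝ, ℝ)
          (fun y => tangentMomentMap IG G I M y ξ) v := by
        have h1 : ContMDiff I.tangent 𝓘(ℝ, ℝ) ∞ (fun y => tangentMomentMap IG G I M y ξ) :=
          (ContinuousLinearMap.contMDiff (ContinuousLinearMap.apply ℝ ℝ ξ)).comp
            contMDiff_tangentMomentMap
        exact h1.mdifferentiable (by simp) v
      rw [he] at hd ⊢
      rw [tangentSymplecticForm_eq]
      exact mfderiv_apply_infinitesimalAction_of_invariant isSmooth_metricForm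
        (pullback_smul_metricForm isometric) ξ v w hd }

end
end

/-! ### Submersions -/

section

variable {E : Type*} [NormedAddCommGroup E] [NormedSpace ℝ E]
  {H : Type*} [TopologicalSpace H] {I : ModelWithCorners ℝ E H} [I.Boundaryless]
  {M : Type*} [TopologicalSpace M] [ChartedSpace H M] [IsManifold I ∞ M]
  {E' : Type*} [NormedAddCommGroup E'] [NormedSpace ℝ E']
  {H' : Type*} [TopologicalSpace H'] {I' : ModelWithCorners ℝ E' H'} [I'.Boundaryless]
  {B : Type*} [TopologicalSpace B] [ChartedSpace H' B] [IsManifold I' ∞ B]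
  {F : Type*} [NormedAddCommGroup F] [NormedSpace ℝ F]

/-- A submersion is locally a product projection. -/
theorem Manifold.IsSubmersionAtOfComplement.exists_local_product {q : M → B} {x : M}
    (h : IsSubmersionAtOfComplement F I I' ∞ q x) :
    ∃ (τ : B × F → M) (χ : M → F), τ (q x, χ x) = x ∧
      ContMDiffAt (I'.prod 𝓘(ℝ, F)) I ∞ τ (q x, χ x) ∧
      (∀ᶠ y in nhds x, ContMDiffAt I 𝓘(ℝ, F) ∞ χ y) ∧
      ∀ᶠ r in nhds (q x, χ x), q (τ r) = r.1 ∧ χ (τ r) = r.2 := by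
  let φ := h.domChart.extend I
  let ψ := h.codChart.extend I'
  let e := h.equiv
  have hxs : x ∈ φ.source := by
    rw [OpenPartialHomeomorph.extend_source]; exact h.mem_domChart_source
  have hw : ∀ y ∈ φ.target, ψ (q (φ.symm y)) = (e y).1 := h.writtenInCharts
  have hφx : (ψ (q x), (e (φ x)).2) = e (φ x) := by
    refine Prod.ext ?_ rfl
    rw [← hw _ (φ.map_source hxs), φ.left_inv hxs]
  have htgt : IsOpen φ.target := by
    have : φ.target = I.symm ⁻¹' h.domChart.target := by
      simp [φ, I.range_eq_univ]
    rw [this]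
    exact h.domChart.open_target.preimage I.continuous_symm
  have hcod : ContMDiffAt I' 𝓘(ℝ, E') ∞ ψ (q x) :=
    h.codChart.contMDiffAt_extend h.codChart_mem_maximalAtlas h.mem_codChart_source
  have hinner : ContMDiffAt (I'.prod 𝓘(ℝ, F)) 𝓘(ℝ, E) ∞
      (fun r : B × F => e.symm (ψ r.1, r.2)) (q x, (e (φ x)).2) := by
    have h1 : ContMDiffAt (I'.prod 𝓘(ℝ, F)) 𝓘(ℝ, E') ∞ (fun r : B × F => ψ r.1)
        (q x, (e (φ x)).2) := ContMDiffAt.comp (g := ψ) (q x, (e (φ x)).2) hcod contMDiffAt_fst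
    exact e.symm.contDiff.contMDiff.contMDiffAt.comp (q x, (e (φ x)).2)
      (h1.prodMk_space contMDiffAt_snd)
  have hval : e.symm (ψ (q x), (e (φ x)).2) = φ x := by
    rw [hφx, e.symm_apply_apply]
  have hsymm : ContMDiffAt 𝓘(ℝ, E) I ∞ φ.symm (φ x) := by
    have := contMDiffOn_extend_symm h.domChart_mem_maximalAtlas
    rw [← OpenPartialHomeomorph.extend_target'] at this
    exact (this _ (φ.map_source hxs)).contMDiffAt (htgt.mem_nhds (φ.map_source hxs))
  refine ⟨fun r => φ.symm (e.symm (ψ r.1, r.2)), fun y => (e (φ y)).2, ?_, ?_, ?_, ?_⟩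
  · simp only [hval, φ.left_inv hxs]
  · exact ContMDiffAt.comp_of_eq hsymm hinner hval
  · filter_upwards [h.domChart.open_source.mem_nhds h.mem_domChart_source] with y hy
    have h1 : ContMDiffAt I 𝓘(ℝ, E) ∞ φ y :=
      h.domChart.contMDiffAt_extend h.domChart_mem_maximalAtlas hy
    have h2 : ContDiff ℝ ∞ (fun z : E => (e z).2) := by fun_prop
    exact h2.contMDiff.contMDiffAt.comp y h1
  · have h1 : ∀ᶠ r in nhds (q x, (e (φ x)).2), e.symm (ψ r.1, r.2) ∈ φ.target := by
      refine hinner.continuousAt.eventually (htgt.mem_nhds ?_)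
      simp only [hval]
      exact φ.map_source hxs
    have h2 : ∀ᶠ r in nhds (q x, (e (φ x)).2), r.1 ∈ ψ.source := by
      refine continuousAt_fst.eventually ?_
      rw [OpenPartialHomeomorph.extend_source]
      exact h.codChart.open_source.mem_nhds h.mem_codChart_source
    filter_upwards [h1, h2] with r hr1 hr2
    refine ⟨ψ.injOn ?_ hr2 ?_, ?_⟩
    · have := φ.map_target hr1
      rw [OpenPartialHomeomorph.extend_source] at this ⊢
      exact h.source_subset_preimage_source this
    · rw [hw _ hr1, e.apply_symm_apply]
    · simp only [φ.right_inv hr1, e.apply_symm_apply]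

/-- A submersion has a smooth local section through every point. -/
theorem Manifold.IsSubmersion.exists_local_section {q : M → B}
    (h : IsSubmersion I I' ∞ q) (x : M) :
    ∃ σ : B → M, σ (q x) = x ∧ ContMDiffAt I' I ∞ σ (q x) ∧ ∀ᶠ b in nhds (q x), q (σ b) = b := by
  obtain ⟨τ, χ, h1, h2, -, h3⟩ :=
    (h.isSubmersionAt x).isSubmersionAtOfComplement_complement.exists_local_product
  refine ⟨fun b => τ (b, χ x), h1, ?_, ?_⟩
  · exact ContMDiffAt.comp (g := τ) (q x) h2 (contMDiffAt_id.prodMk contMDiffAt_const)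
  · have : Filter.Tendsto (fun b : B => (b, χ x)) (nhds (q x)) (nhds (q x, χ x)) :=
      Continuous.tendsto (by fun_prop) _
    filter_upwards [this.eventually h3] with b hb using hb.1

theorem Manifold.IsSubmersion.isOpenMap {q : M → B} (h : IsSubmersion I I' ∞ q) :
    IsOpenMap q := by
  rw [isOpenMap_iff_nhds_le]
  intro x s hs
  obtain ⟨σ, h1, h2, h3⟩ := h.exists_local_section x
  have : σ ⁻¹' (q ⁻¹' s) ∈ nhds (q x) := h2.continuousAt.preimage_mem_nhds (by rw [h1]; exact hs)
  filter_upwards [this, h3] with b hb hb'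
  rw [← hb']
  exact hb

theorem Manifold.IsSubmersion.contMDiff' {q : M → B} (h : IsSubmersion I I' ∞ q) :
    ContMDiff I I' ∞ q := fun x => (h.isSubmersionAt x).contMDiffAt

theorem Manifold.IsSubmersion.mfderiv_surjective {q : M → B} (h : IsSubmersion I I' ∞ q) (x : M) :
    Function.Surjective (mfderiv I I' q x) := by
  obtain ⟨σ, h1, h2, h3⟩ := h.exists_local_section x
  have e := mfderiv_comp_of_eq (I := I') (I' := I) (I'' := I') (g := q) (f := σ) (x := q x)
    (h.contMDiff'.mdifferentiable (by simp) x) (h2.mdifferentiableAt (by simp)) h1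
  have e' : q ∘ σ =ᶠ[nhds (q x)] id := h3
  rw [e'.mfderiv_eq, mfderiv_id] at e
  intro w
  refine ⟨(mfderiv I' I σ (q x) w : E), ?_⟩
  refine Eq.trans ?_ (congrArg (fun A : E' →L[ℝ] E' => A w) e).symm
  exact mfderiv_apply_congr_point q h1.symm _

end

theorem LinearMap.range_eq_ker_of_finrank_le {V₁ V₂ V₃ : Type*} [AddCommGroup V₁] [Module ℝ V₁]
    [AddCommGroup V₂] [Module ℝ V₂] [FiniteDimensional ℝ V₂] [AddCommGroup V₃] [Module ℝ V₃]
    {f : V₁ →ₗ[ℝ] V₂} {g : V₂ →ₗ[ℝ] V₃} (h : ∀ x, g (f x) = 0) (hf : Function.Injective f)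
    (hg : Function.Surjective g)
    (hdim : Module.finrank ℝ V₂ ≤ Module.finrank ℝ V₃ + Module.finrank ℝ V₁) :
    LinearMap.range f = LinearMap.ker g := by
  refine Submodule.eq_of_le_of_finrank_le ?_ ?_
  · rintro _ ⟨x, rfl⟩
    exact h x
  · have h1 := g.finrank_range_add_finrank_ker
    rw [LinearMap.range_eq_top.2 hg, finrank_top] at h1
    rw [LinearMap.finrank_range_of_inj hf]
    omega

/-! ### Free actions whose orbits are the fibres of a submersion -/

section

variable {EG : Type*} [NormedAddCommGroup EG] [NormedSpace ℝ EG] [FiniteDimensional ℝ EG]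
  {HG : Type*} [TopologicalSpace HG] {IG : ModelWithCorners ℝ EG HG} [IG.Boundaryless]
  {G : Type*} [TopologicalSpace G] [ChartedSpace HG G] [Group G] [LieGroup IG ∞ G]
  {E : Type*} [NormedAddCommGroup E] [NormedSpace ℝ E] [FiniteDimensional ℝ E]
  {H : Type*} [TopologicalSpace H] {I : ModelWithCorners ℝ E H} [I.Boundaryless]
  {M : Type*} [TopologicalSpace M] [ChartedSpace H M] [IsManifold I ∞ M]
  [MulAction G M] [ContMDiffSMul IG I ∞ G M]

theorem infinitesimalAction_injective (free : ∀ (g : G) (p : M), g • p = p → g = 1) (p : M) :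
    Function.Injective (infinitesimalAction IG G I p) := by
  rw [injective_iff_map_eq_zero]
  intro ξ hξ
  haveI : LieGroup IG 1 G := LieGroup.of_le (m := 1) (n := ∞) (by simp)
  haveI : LieGroup IG (minSmoothness ℝ 3) G := LieGroup.of_le (m := minSmoothness ℝ 3) (n := ∞)
    (by rw [minSmoothness_of_isRCLikeNormedField]; exact ENat.LEInfty.out)
  haveI : IsManifold IG 1 G := IsManifold.of_le (m := 1) (n := ∞) (by simp)
  haveI : IsManifold I 1 M := IsManifold.of_le (m := 1) (n := ∞) (by simp)
  haveI : CompleteSpace EG := FiniteDimensional.complete ℝ EG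
  have hV := (contMDiff_mulInvariantVectorField (I := IG) (G := G) ξ).contMDiffAt (x := 1)
  obtain ⟨γ, hγ0, hγ⟩ := exists_isMIntegralCurveAt_of_contMDiffAt_boundaryless 0
    (hV.of_le (by simp))
  have hz : ∀ g : G, (mfderiv IG I (fun h : G => h • p) g (mulInvariantVectorField ξ g) : E) =
      0 := by
    intro g
    have hf : (fun h : G => h • p) ∘ (fun h : G => g * h) =
        (fun x : M => g • x) ∘ fun h : G => h • p := by
      funext h
      simp [mul_smul]
    have hm : MDifferentiable IG IG (fun h : G => g * h) :=
      (contMDiff_mul_left (I := IG) (n := ∞)).mdifferentiable (by simp)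
    have ho := mdifferentiable_smul_const (IG := IG) (G := G) (I := I) p
    have e1 := mfderiv_comp_of_eq (I := IG) (I' := IG) (I'' := I) (g := fun h : G => h • p)
      (f := fun h : G => g * h) (x := (1 : G)) (y := g) (ho _) (hm _) (mul_one g)
    have e2 := mfderiv_comp (I := IG) (I' := I) (I'' := I) (g := fun x : M => g • x)
      (f := fun h : G => h • p) (1 : G) (mdifferentiable_const_smul IG g _) (ho _)
    rw [hf] at e1
    refine (mfderiv_apply_congr_point (fun h : G => h • p) (mul_one g).symm _).trans ?_
    refine (congrArg (fun A : EG →L[ℝ] E => A ξ) (e1.symm.trans e2)).trans ?_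
    exact (congrArg (fun u : E => (mfderiv I I (fun x : M => g • x) ((1 : G) • p) u : E)) hξ).trans
      (map_zero _)
  have hc : IsMIntegralCurveAt (I := I) (fun t => γ t • p) (fun _ => 0) 0 := by
    filter_upwards [hγ] with t ht
    have h1 := (mdifferentiable_smul_const (IG := IG) (G := G) (I := I) p (γ t)).hasMFDerivAt.comp
      t ht
    refine h1.congr_mfderiv ?_
    ext
    refine (congrArg (mfderiv IG I (fun h : G => h • p) (γ t)) (one_smul ℝ _)).trans ?_
    exact (hz (γ t)).trans (smul_zero _).symm
  have hconst : (fun t => γ t • p) =ᶠ[nhds 0] fun _ => γ 0 • p :=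
    isMIntegralCurveAt_eventuallyEq_of_contMDiffAt_boundaryless
      (Bundle.contMDiff_zeroSection ℝ (TangentSpace I : M → Type _)).contMDiffAt hc
      ((isMIntegralCurve_const rfl).isMIntegralCurveAt 0) rfl
  have hγ1 : γ =ᶠ[nhds 0] fun _ => 1 := by
    filter_upwards [hconst] with t ht
    rw [hγ0, one_smul] at ht
    exact free _ _ ht
  have h1 := hγ.self_of_nhds.congr_of_eventuallyEq hγ1.symm
  have h2 := hasMFDerivAt_unique h1 (hasMFDerivAt_const (I := 𝓘(ℝ, ℝ)) (I' := IG) (1 : G) (0 : ℝ))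
  have h3 : (mulInvariantVectorField ξ (γ 0) : EG) = 0 :=
    (one_smul ℝ _).symm.trans (congrArg (fun A : ℝ →L[ℝ] EG => A 1) h2)
  rw [hγ0] at h3
  have h4 : (fun h : G => 1 * h) = id := funext one_mul
  unfold mulInvariantVectorField at h3
  rw [h4, mfderiv_id] at h3
  exact h3

/-- The orbits of a second countable Lie group have at most its dimension: if they are the fibres
of a submersion, then the relative dimension is at most the dimension of the group. -/
theorem Manifold.IsSubmersionAtOfComplement.finrank_complement_le
    (IG : ModelWithCorners ℝ EG HG) [IG.Boundaryless] [LieGroup IG ∞ G] [ContMDiffSMul IG I ∞ G M]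
    [SecondCountableTopology G]
    {E' : Type*} [NormedAddCommGroup E'] [NormedSpace ℝ E']
    {H' : Type*} [TopologicalSpace H'] {I' : ModelWithCorners ℝ E' H'} [I'.Boundaryless]
    {B : Type*} [TopologicalSpace B] [ChartedSpace H' B] [IsManifold I' ∞ B]
    {F : Type*} [NormedAddCommGroup F] [NormedSpace ℝ F] [FiniteDimensional ℝ F] {q : M → B} {p : M}
    (hq : IsSubmersionAtOfComplement F I I' ∞ q p)
    (orbit : ∀ x, q x = q p → ∃ g : G, g • p = x) :
    Module.finrank ℝ F ≤ Module.finrank ℝ EG := by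
  obtain ⟨τ, χ, hτ, hτs, hχ, hr⟩ := hq.exists_local_product
  let U : Set G := {g | ContMDiffAt I 𝓘(ℝ, F) ∞ χ (g • p)}
  let r : G → F := fun g => χ (g • p)
  have hinc : Filter.Tendsto (fun u : F => (q p, u)) (nhds (χ p)) (nhds (q p, χ p)) :=
    Continuous.tendsto (by fun_prop) _
  have hU : r '' U ∈ nhds (χ p) := by
    have h1 : ∀ᶠ u in nhds (χ p), ContMDiffAt I 𝓘(ℝ, F) ∞ χ (τ (q p, u)) := by
      have := (hτs.continuousAt.tendsto.comp hinc)
      rw [hτ] at this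
      exact this.eventually hχ
    filter_upwards [h1, hinc.eventually hr] with u hu1 hu2
    obtain ⟨g, hg⟩ := orbit _ hu2.1
    exact ⟨g, by simpa [U, hg] using hu1, by simpa [r, hg] using hu2.2⟩
  obtain ⟨s, hs, hsU⟩ := TopologicalSpace.countable_cover_nhds
    (fun g : G => extChartAt_source_mem_nhds (I := IG) g)
  let V : G → Set EG := fun g => {y ∈ (extChartAt IG g).target | (extChartAt IG g).symm y ∈ U}
  have hcover : r '' U ⊆ ⋃ g ∈ s, (r ∘ (extChartAt IG g).symm) '' V g := by
    rintro _ ⟨h, hh, rfl⟩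
    obtain ⟨g, hg, hgh⟩ : ∃ g ∈ s, h ∈ (extChartAt IG g).source := by
      simpa using (hsU.symm ▸ Set.mem_univ h : h ∈ ⋃ x ∈ s, (extChartAt IG x).source)
    have e := (extChartAt IG g).left_inv hgh
    refine Set.mem_biUnion hg ⟨extChartAt IG g h, ⟨(extChartAt IG g).map_source hgh, ?_⟩, ?_⟩
    · rw [e]; exact hh
    · simp only [Function.comp_apply, e]
  have hdim : ∀ g, dimH ((r ∘ (extChartAt IG g).symm) '' V g) ≤ Module.finrank ℝ EG := by
    intro g
    rw [← Real.dimH_univ_eq_finrank EG]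
    refine le_trans (dimH_image_le_of_locally_lipschitzOn fun y hy => ?_)
      (dimH_mono (Set.subset_univ _))
    have h1 : ContMDiffAt 𝓘(ℝ, EG) 𝓘(ℝ, F) ∞ (r ∘ (extChartAt IG g).symm) y := by
      have ho : ContMDiff IG I ∞ (fun h : G => h • p) :=
        (contMDiff_smul (I := IG) (I' := I) (n := ∞) (G := G) (M := M)).comp
          (contMDiff_id.prodMk contMDiff_const)
      have h2 : ContMDiffAt IG 𝓘(ℝ, F) ∞ r ((extChartAt IG g).symm y) :=
        ContMDiffAt.comp (g := χ) _ hy.2 ho.contMDiffAt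
      exact h2.comp y (MForm.contMDiffAt_extChartAt_symm g hy.1)
    obtain ⟨K, t, ht, hK⟩ :=
      (h1.contDiffAt.of_le (by simp : (1 : WithTop ℕ∞) ≤ ∞)).exists_lipschitzOnWith
    exact ⟨K, t, mem_nhdsWithin_of_mem_nhds ht, hK⟩
  have : (Module.finrank ℝ F : ENNReal) ≤ Module.finrank ℝ EG := by
    rw [← Real.dimH_of_mem_nhds hU]
    refine (dimH_mono hcover).trans ?_
    rw [dimH_bUnion hs]
    exact iSup₂_le fun g _ => hdim g
  exact_mod_cast this

theorem finrank_le_finrank_add_finrank_of_orbit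
    (IG : ModelWithCorners ℝ EG HG) [IG.Boundaryless] [LieGroup IG ∞ G] [ContMDiffSMul IG I ∞ G M]
    [SecondCountableTopology G]
    {E' : Type*} [NormedAddCommGroup E'] [NormedSpace ℝ E'] [FiniteDimensional ℝ E']
    {H' : Type*} [TopologicalSpace H'] {I' : ModelWithCorners ℝ E' H'} [I'.Boundaryless]
    {B : Type*} [TopologicalSpace B] [ChartedSpace H' B] [IsManifold I' ∞ B] {q : M → B}
    (hq : Manifold.IsSubmersion I I' ∞ q) {p : M} (orbit : ∀ x, q x = q p → ∃ g : G, g • p = x) :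
    Module.finrank ℝ E ≤ Module.finrank ℝ E' + Module.finrank ℝ EG := by
  have hp := (hq.isSubmersionAt p).isSubmersionAtOfComplement_complement
  set F := (hq.isSubmersionAt p).complement
  haveI : FiniteDimensional ℝ (E' × F) := hp.equiv.toLinearEquiv.finiteDimensional
  haveI : FiniteDimensional ℝ F := FiniteDimensional.of_surjective (LinearMap.snd ℝ E' F)
    LinearMap.snd_surjective
  have h1 := hp.finrank_complement_le IG (G := G) orbit
  have h2 := hp.equiv.toLinearEquiv.finrank_eq
  rw [Module.finrank_prod] at h2
  omega

/-- If the orbits of a free action of a second countable Lie group are the fibres of a submersion,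
then the vertical vectors are the values of the vector fields generated by the group. -/
theorem range_infinitesimalAction_eq_ker [SecondCountableTopology G]
    {E' : Type*} [NormedAddCommGroup E'] [NormedSpace ℝ E'] [FiniteDimensional ℝ E']
    {H' : Type*} [TopologicalSpace H'] {I' : ModelWithCorners ℝ E' H'} [I'.Boundaryless]
    {B : Type*} [TopologicalSpace B] [ChartedSpace H' B] [IsManifold I' ∞ B]
    (free : ∀ (g : G) (p : M), g • p = p → g = 1) {q : M → B}
    (hq : Manifold.IsSubmersion I I' ∞ q) (orbit : ∀ x y, q x = q y ↔ ∃ g : G, g • y = x) (p : M) :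
    LinearMap.range (infinitesimalAction IG G I p : EG →L[ℝ] E).toLinearMap =
      LinearMap.ker (mfderiv I I' q p : E →L[ℝ] E').toLinearMap := by
  refine LinearMap.range_eq_ker_of_finrank_le (V₂ := E) (V₃ := E') (fun ξ => ?_)
    (infinitesimalAction_injective free p) (hq.mfderiv_surjective p)
    (finrank_le_finrank_add_finrank_of_orbit IG (G := G) (p := p) hq fun x hx => (orbit _ _).1 hx)
  have e := mfderiv_comp_of_eq (I := IG) (I' := I) (I'' := I') (g := q)
    (f := fun g : G => g • p) (x := (1 : G)) (y := p)
    (hq.contMDiff'.mdifferentiable (by simp) _) (mdifferentiable_smul_const p _) (one_smul G p)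
  have hc : q ∘ (fun g : G => g • p) = fun _ => q p :=
    funext fun g => (orbit _ _).2 ⟨g, rfl⟩
  rw [hc, mfderiv_const] at e
  refine (mfderiv_apply_congr_point q (one_smul G p).symm _).trans ?_
  exact (congrArg (fun A : EG →L[ℝ] E' => A ξ) e).symm

theorem tangentMomentMap_preimage_zero [SecondCountableTopology G]
    [Bundle.RiemannianBundle (fun x : M => TangentSpace I x)]
    {E' : Type*} [NormedAddCommGroup E'] [NormedSpace ℝ E'] [FiniteDimensional ℝ E']
    {H' : Type*} [TopologicalSpace H'] {I' : ModelWithCorners ℝ E' H'} [I'.Boundaryless]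
    {B : Type*} [TopologicalSpace B] [ChartedSpace H' B] [IsManifold I' ∞ B]
    (free : ∀ (g : G) (p : M), g • p = p → g = 1) {q : M → B}
    (hq : Manifold.IsSubmersion I I' ∞ q) (orbit : ∀ x y, q x = q y ↔ ∃ g : G, g • y = x) :
    tangentMomentMap IG G I M ⁻¹' {0} =
      {v : TangentBundle I M | IsHorizontal I I' q v.1 v.2} := by
  ext v
  have hr := range_infinitesimalAction_eq_ker (IG := IG) free hq orbit v.1
  constructor
  · intro hv w hw
    have : (w : E) ∈ LinearMap.ker (mfderiv I I' q v.1 : E →L[ℝ] E').toLinearMap := hw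
    rw [← hr] at this
    obtain ⟨ξ, hξ⟩ := this
    have h1 : tangentMomentMap IG G I M v ξ = 0 := by
      rw [show tangentMomentMap IG G I M v = 0 from hv]; rfl
    rw [tangentMomentMap_apply] at h1
    exact (congrArg (fun u : E => @inner ℝ (TangentSpace I v.1) _ v.2 u) hξ.symm).trans h1
  · intro hv
    refine ContinuousLinearMap.ext fun ξ => ?_
    refine hv _ ?_
    have : (infinitesimalAction IG G I v.1 ξ : E) ∈
        LinearMap.ker (mfderiv I I' q v.1 : E →L[ℝ] E').toLinearMap := by
      rw [← hr]; exact ⟨ξ, rfl⟩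
    exact this

end

/-! ### Transport of smooth structures along homeomorphisms -/

section

variable {E : Type*} [NormedAddCommGroup E] [NormedSpace ℝ E]
  {H : Type*} [TopologicalSpace H] {I : ModelWithCorners ℝ E H}
  {X : Type*} [TopologicalSpace X] {Y : Type*} [TopologicalSpace Y] [ChartedSpace H Y]

/-- The charted space structure transported along a homeomorphism. -/
@[reducible]
def Homeomorph.transportChartedSpace (e : X ≃ₜ Y) : ChartedSpace H X where
  atlas := (fun c => e.toOpenPartialHomeomorph.trans c) '' atlas H Y
  chartAt x := e.toOpenPartialHomeomorph.trans (chartAt H (e x))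
  mem_chart_source x := by simp
  chart_mem_atlas x := ⟨_, chart_mem_atlas H (e x), rfl⟩

theorem Homeomorph.isManifold_transport [IsManifold I ∞ Y] (e : X ≃ₜ Y) :
    letI : ChartedSpace H X := e.transportChartedSpace
    IsManifold I ∞ X := by
  letI : ChartedSpace H X := e.transportChartedSpace
  have : HasGroupoid X (contDiffGroupoid ∞ I) := by
    constructor
    rintro _ _ ⟨c, hc, rfl⟩ ⟨c', hc', rfl⟩
    refine (contDiffGroupoid ∞ I).mem_of_eqOnSource
      (HasGroupoid.compatible (G := contDiffGroupoid ∞ I) hc hc') ?_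
    rw [OpenPartialHomeomorph.trans_symm_eq_symm_trans_symm, OpenPartialHomeomorph.trans_assoc,
      ← OpenPartialHomeomorph.trans_assoc e.toOpenPartialHomeomorph.symm]
    refine OpenPartialHomeomorph.EqOnSource.trans' (OpenPartialHomeomorph.eqOnSource_refl _) ?_
    constructor
    · simp
    · intro y _
      simp
  exact IsManifold.mk' I ∞ X

/-- A homeomorphism is a diffeomorphism for the transported structure. -/
def Homeomorph.transportDiffeomorph [IsManifold I ∞ Y] (e : X ≃ₜ Y) :
    letI : ChartedSpace H X := e.transportChartedSpace
    Diffeomorph I I X Y ∞ :=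
  letI : ChartedSpace H X := e.transportChartedSpace
  haveI : IsManifold I ∞ X := e.isManifold_transport
  { e.toEquiv with
    contMDiff_toFun := fun x => by
      have h1 : ContMDiffAt I I ∞ (chartAt H x) x :=
        contMDiffAt_of_mem_maximalAtlas (IsManifold.chart_mem_maximalAtlas x)
          (mem_chart_source H x)
      have h2 : ContMDiffAt I I ∞ (chartAt H (e x)).symm (chartAt H (e x) (e x)) :=
        contMDiffAt_symm_of_mem_maximalAtlas (IsManifold.chart_mem_maximalAtlas (e x))
          (mem_chart_target H (e x))
      have h3 : ContMDiffAt I I ∞ ((chartAt H (e x)).symm ∘ chartAt H x) x :=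
        ContMDiffAt.comp x h2 h1
      refine h3.congr_of_eventuallyEq ?_
      filter_upwards [e.continuous.continuousAt.preimage_mem_nhds
        (chart_source_mem_nhds H (e x))] with y hy
      exact ((chartAt H (e x)).left_inv hy).symm
    contMDiff_invFun := fun y => by
      obtain ⟨x, rfl⟩ := e.surjective y
      have h1 : ContMDiffAt I I ∞ (chartAt H (e x)) (e x) :=
        contMDiffAt_of_mem_maximalAtlas (IsManifold.chart_mem_maximalAtlas (e x))
          (mem_chart_source H (e x))
      have h2 : ContMDiffAt I I ∞ (chartAt H x).symm (chartAt H x x) :=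
        contMDiffAt_symm_of_mem_maximalAtlas (IsManifold.chart_mem_maximalAtlas x)
          (mem_chart_target H x)
      have h3 : ContMDiffAt I I ∞ ((chartAt H x).symm ∘ chartAt H (e x)) (e x) :=
        ContMDiffAt.comp (e x) h2 h1
      refine h3.congr_of_eventuallyEq ?_
      filter_upwards [chart_source_mem_nhds H (e x)] with y hy
      exact congrArg e.symm ((chartAt H (e x)).left_inv hy).symm }

end

/-! ### Submersions and diffeomorphisms -/

section

variable {E : Type*} [NormedAddCommGroup E] [NormedSpace ℝ E]
  {H : Type*} [TopologicalSpace H] {I : ModelWithCorners ℝ E H}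
  {X : Type*} [TopologicalSpace X] [ChartedSpace H X] [IsManifold I ∞ X]
  {Y : Type*} [TopologicalSpace Y] [ChartedSpace H Y] [IsManifold I ∞ Y]
  {E' : Type*} [NormedAddCommGroup E'] [NormedSpace ℝ E']
  {H' : Type*} [TopologicalSpace H'] {I' : ModelWithCorners ℝ E' H'}
  {X' : Type*} [TopologicalSpace X'] [ChartedSpace H' X'] [IsManifold I' ∞ X']
  {Y' : Type*} [TopologicalSpace Y'] [ChartedSpace H' Y'] [IsManifold I' ∞ Y']
  {F : Type*} [NormedAddCommGroup F] [NormedSpace ℝ F]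

theorem Diffeomorph.trans_mem_maximalAtlas (d : Diffeomorph I I X Y ∞)
    {c : OpenPartialHomeomorph Y H} (hc : c ∈ IsManifold.maximalAtlas I ∞ Y) :
    d.toHomeomorph.toOpenPartialHomeomorph.trans c ∈ IsManifold.maximalAtlas I ∞ X := by
  refine OpenPartialHomeomorph.mem_maximalAtlas_of_contMDiffOn _ ?_ ?_
  · refine (contMDiffOn_of_mem_maximalAtlas hc).comp d.contMDiff.contMDiffOn fun x hx => ?_
    simpa using hx
  · refine d.symm.contMDiff.comp_contMDiffOn ((contMDiffOn_symm_of_mem_maximalAtlas hc).mono ?_)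
    intro y hy
    simpa using hy

theorem Manifold.IsSubmersionOfComplement.conj_diffeomorph {f : Y → Y'}
    (hf : IsSubmersionOfComplement F I I' ∞ f) (d : Diffeomorph I I X Y ∞)
    (d' : Diffeomorph I' I' X' Y' ∞) : IsSubmersionOfComplement F I I' ∞ (d'.symm ∘ f ∘ d) := by
  intro x
  have h := hf (d x)
  refine IsSubmersionAtOfComplement.mk_of_continuousAt ?_ h.equiv
    (d.toHomeomorph.toOpenPartialHomeomorph.trans h.domChart)
    (d'.toHomeomorph.toOpenPartialHomeomorph.trans h.codChart) ?_ ?_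
    (d.trans_mem_maximalAtlas h.domChart_mem_maximalAtlas)
    (d'.trans_mem_maximalAtlas h.codChart_mem_maximalAtlas) ?_
  · exact d'.symm.continuous.continuousAt.comp
      (h.contMDiffAt.continuousAt.comp d.continuous.continuousAt)
  · simpa using h.mem_domChart_source
  · simpa using h.mem_codChart_source
  · intro y hy
    have hy' : y ∈ (h.domChart.extend I).target := by simpa using hy
    have hw := h.writtenInCharts hy'
    refine Eq.trans ?_ hw
    simp

end

/-! ### Pullback of the tangent bundle along a submersion -/

section

variable {E : Type*} [NormedAddCommGroup E] [NormedSpace ℝ E]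
  {H : Type*} [TopologicalSpace H] {I : ModelWithCorners ℝ E H}
  {M : Type*} [TopologicalSpace M] [ChartedSpace H M] [IsManifold I ∞ M]
  {E' : Type*} [NormedAddCommGroup E'] [NormedSpace ℝ E']
  {H' : Type*} [TopologicalSpace H'] {I' : ModelWithCorners ℝ E' H'}
  {B : Type*} [TopologicalSpace B] [ChartedSpace H' B] [IsManifold I' ∞ B]
  {F : Type*} [NormedAddCommGroup F] [NormedSpace ℝ F]
  (q : ContMDiffMap I I' M B ∞)

/-- The pullback of the tangent bundle of the target. -/
abbrev PullbackTangentBundle : Type _ :=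
  Bundle.TotalSpace E' ((q : M → B) *ᵖ (TangentSpace I' : B → Type _))

/-- The tautological map from the pullback bundle. -/
abbrev PullbackTangentBundle.lift : PullbackTangentBundle q → TangentBundle I' B :=
  Bundle.Pullback.lift (q : M → B)

theorem contMDiff_pullbackTangentBundle_lift :
    ContMDiff (I.prod 𝓘(ℝ, E')) I'.tangent ∞ (PullbackTangentBundle.lift q) := by
  intro y
  have h := (contMDiffAt_id : ContMDiffAt (I.prod 𝓘(ℝ, E')) (I.prod 𝓘(ℝ, E')) ∞
    (id : PullbackTangentBundle q → _) y)
  rw [Bundle.contMDiffAt_totalSpace] at h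
  rw [Bundle.contMDiffAt_totalSpace]
  exact ⟨q.contMDiff.contMDiffAt.comp y h.1, h.2⟩

theorem contMDiffAt_pullbackTangentBundle {E₁ : Type*} [NormedAddCommGroup E₁] [NormedSpace ℝ E₁]
    {H₁ : Type*} [TopologicalSpace H₁] {I₁ : ModelWithCorners ℝ E₁ H₁}
    {N : Type*} [TopologicalSpace N] [ChartedSpace H₁ N] {f : N → PullbackTangentBundle q} {x : N}
    (h1 : ContMDiffAt I₁ I ∞ (fun y => (f y).1) x)
    (h2 : ContMDiffAt I₁ I'.tangent ∞ (fun y => PullbackTangentBundle.lift q (f y)) x) :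
    ContMDiffAt I₁ (I.prod 𝓘(ℝ, E')) ∞ f x := by
  rw [Bundle.contMDiffAt_totalSpace] at h2 ⊢
  exact ⟨h1, h2.2⟩

theorem Bundle.Trivialization.trans_prod_mem_maximalAtlas {F₁ : Type*} [NormedAddCommGroup F₁]
    [NormedSpace ℝ F₁] {V : M → Type*} [∀ x, AddCommMonoid (V x)] [∀ x, Module ℝ (V x)]
    [TopologicalSpace (Bundle.TotalSpace F₁ V)] [∀ x, TopologicalSpace (V x)] [FiberBundle F₁ V]
    [VectorBundle ℝ F₁ V] [ContMDiffVectorBundle ∞ F₁ V I]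
    (t : Bundle.Trivialization F₁ (Bundle.TotalSpace.proj : Bundle.TotalSpace F₁ V → M))
    [MemTrivializationAtlas t] {c : OpenPartialHomeomorph M H}
    (hc : c ∈ IsManifold.maximalAtlas I ∞ M) :
    t.toOpenPartialHomeomorph.trans (c.prod (OpenPartialHomeomorph.refl F₁)) ∈
      IsManifold.maximalAtlas (I.prod 𝓘(ℝ, F₁)) ∞ (Bundle.TotalSpace F₁ V) := by
  have e : prodChartedSpace H H F₁ F₁ = chartedSpaceSelf (ModelProd H F₁) := chartedSpaceSelf_prod
  refine OpenPartialHomeomorph.mem_maximalAtlas_of_contMDiffOn _ ?_ ?_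
  · rw [← e]
    have h1 : ContMDiffOn (I.prod 𝓘(ℝ, F₁)) (I.prod 𝓘(ℝ, F₁)) ∞
        (Prod.map c id : M × F₁ → H × F₁) (c.source ×ˢ Set.univ) :=
      (contMDiffOn_of_mem_maximalAtlas hc).prodMap contMDiffOn_id
    exact h1.comp (t.contMDiffOn.mono fun x hx => hx.1) fun x hx => hx.2
  · rw [← e]
    have h1 : ContMDiffOn (I.prod 𝓘(ℝ, F₁)) (I.prod 𝓘(ℝ, F₁)) ∞
        (Prod.map c.symm id : H × F₁ → M × F₁) (c.target ×ˢ Set.univ) :=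
      (contMDiffOn_symm_of_mem_maximalAtlas hc).prodMap contMDiffOn_id
    have h2 := t.contMDiffOn_symm.comp (I := I.prod 𝓘(ℝ, F₁)) (n := ∞) (h1.mono (fun x hx => hx.1 :
      (c.target ×ˢ Set.univ) ∩ Prod.map c.symm id ⁻¹' t.target ⊆ _)) fun x hx => hx.2
    exact h2

theorem isSubmersionOfComplement_pullbackTangentBundle_lift
    (hq : Manifold.IsSubmersionOfComplement F I I' ∞ q) :
    Manifold.IsSubmersionOfComplement F (I.prod 𝓘(ℝ, E')) I'.tangent ∞
      (PullbackTangentBundle.lift q) := by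
  intro y
  have h := hq y.1
  let t := trivializationAt E' (TangentSpace I' : B → Type _) (q y.1)
  let eqv : (E × E') ≃L[ℝ] (E' × E') × F :=
    (h.equiv.prodCongr (ContinuousLinearEquiv.refl ℝ E')).trans
      ((ContinuousLinearEquiv.prodAssoc ℝ E' F E').trans
        (((ContinuousLinearEquiv.refl ℝ E').prodCongr (ContinuousLinearEquiv.prodComm ℝ F E')).trans
          (ContinuousLinearEquiv.prodAssoc ℝ E' E' F).symm))
  haveI : MemTrivializationAtlas (t.pullback q) := ⟨⟨t, inferInstance, rfl⟩⟩
  have hy : q y.1 ∈ t.baseSet := FiberBundle.mem_baseSet_trivializationAt' _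
  refine Manifold.IsSubmersionAtOfComplement.mk_of_continuousAt
    (contMDiff_pullbackTangentBundle_lift q).continuous.continuousAt eqv
    ((t.pullback q).toOpenPartialHomeomorph.trans
      (h.domChart.prod (OpenPartialHomeomorph.refl E')))
    (t.toOpenPartialHomeomorph.trans (h.codChart.prod (OpenPartialHomeomorph.refl E')))
    ?_ ?_ ((t.pullback q).trans_prod_mem_maximalAtlas h.domChart_mem_maximalAtlas)
    (t.trans_prod_mem_maximalAtlas h.codChart_mem_maximalAtlas) ?_
  · have : PullbackTangentBundle.lift q y ∈ t.source := t.mem_source.2 hy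
    simpa using ⟨this, h.mem_domChart_source⟩
  · have h1 : PullbackTangentBundle.lift q y ∈ t.source := t.mem_source.2 hy
    have h2 : (t (PullbackTangentBundle.lift q y)).1 = q y.1 := t.coe_fst h1
    have h3 := h.mem_codChart_source
    simp only [mfld_simps]
    exact ⟨h1, by rw [h2]; exact h3⟩
  · intro z hz
    have hz1 : z.1 ∈ (h.domChart.extend I).target := by
      simp only [mfld_simps] at hz ⊢
      exact ⟨hz.1, hz.2.1.1⟩
    have hz2 : q ((h.domChart.extend I).symm z.1) ∈ t.baseSet := by
      simp only [mfld_simps] at hz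
      exact (t.pullback q).mem_target.1 hz.2.2
    have hw := h.writtenInCharts hz1
    have h1 := (t.pullback q).apply_symm_apply' (b := (h.domChart.extend I).symm z.1) (x := z.2) hz2
    set s := (t.pullback q).toOpenPartialHomeomorph.symm ((h.domChart.extend I).symm z.1, z.2)
      with hs
    have h2 : s.1 = (h.domChart.extend I).symm z.1 := congrArg Prod.fst h1
    have h3 : (t (PullbackTangentBundle.lift q s)).2 = z.2 := congrArg Prod.snd h1
    have h4 : (t (PullbackTangentBundle.lift q s)).1 = q ((h.domChart.extend I).symm z.1) := by
      rw [← h2]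
      refine t.coe_fst (t.mem_source.2 ?_)
      change q s.1 ∈ t.baseSet
      rw [h2]
      exact hz2
    refine Prod.ext ?_ h3
    refine Eq.trans ?_ hw
    exact congrArg (h.codChart.extend I') h4

end

/-! ### Horizontal lifts -/

section

variable {E : Type*} [NormedAddCommGroup E] [NormedSpace ℝ E] [FiniteDimensional ℝ E]

/-- The Gram form of a linear map to an inner product space. -/
def gramMap {V : Type*} [NormedAddCommGroup V] [InnerProductSpace ℝ V] (σ : E →L[ℝ] V) :
    E →L[ℝ] E →L[ℝ] ℝ :=
  LinearMap.toContinuousLinearMap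
    { toFun := fun a => (innerSL ℝ (σ a)).comp σ
      map_add' := fun a b => by ext; simp
      map_smul' := fun c a => by ext; simp }

theorem gramMap_apply {V : Type*} [NormedAddCommGroup V] [InnerProductSpace ℝ V] (σ : E →L[ℝ] V)
    (a b : E) : gramMap σ a b = inner ℝ (σ a) (σ b) := rfl

theorem exists_equiv_gramMap {V : Type*} [NormedAddCommGroup V] [InnerProductSpace ℝ V]
    {σ : E →L[ℝ] V} (hσ : Function.Injective σ) :
    ∃ e : E ≃L[ℝ] (E →L[ℝ] ℝ), (e : E →L[ℝ] E →L[ℝ] ℝ) = gramMap σ := by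
  have hinj : Function.Injective (gramMap σ).toLinearMap := by
    rw [injective_iff_map_eq_zero]
    intro a ha
    have h : inner ℝ (σ a) (σ a) = 0 := congrArg (fun l : E →L[ℝ] ℝ => l a) ha
    exact (map_eq_zero_iff σ hσ).1 (inner_self_eq_zero.1 h)
  have hdim : Module.finrank ℝ E = Module.finrank ℝ (E →L[ℝ] ℝ) := by
    rw [← (LinearMap.toContinuousLinearMap (𝕜 := ℝ) (E := E) (F' := ℝ)).finrank_eq,
      Module.finrank_linearMap, Module.finrank_self, mul_one]
  exact ⟨(LinearMap.linearEquivOfInjective _ hinj hdim).toContinuousLinearEquiv, rfl⟩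

variable {H : Type*} [TopologicalSpace H] {I : ModelWithCorners ℝ E H}
  {M : Type*} [TopologicalSpace M] [ChartedSpace H M] [IsManifold I ∞ M]
  [Bundle.RiemannianBundle (fun x : M => TangentSpace I x)]
  [IsContMDiffRiemannianBundle I ∞ E (fun x : M => TangentSpace I x)]

theorem contMDiffAt_symm_trivializationAt (p : M) (a : E) :
    ContMDiffAt I I.tangent ∞ (fun x : M => (⟨x, (trivializationAt E
      (fun x : M => TangentSpace I x) p).symmL ℝ x a⟩ : TangentBundle I M)) p := by
  rw [Bundle.contMDiffAt_totalSpace]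
  refine ⟨contMDiffAt_id, (contMDiffAt_const (c := a)).congr_of_eventuallyEq ?_⟩
  filter_upwards [(trivializationAt E (fun x : M => TangentSpace I x) p).open_baseSet.mem_nhds
    (FiberBundle.mem_baseSet_trivializationAt' p)] with x hx
  rw [Bundle.Trivialization.symmL_apply _ hx]
  exact congrArg Prod.snd
    ((trivializationAt E (fun x : M => TangentSpace I x) p).apply_mk_symm hx a)

/-- A vector field along a smooth map is smooth if its inner products with local frames are. -/
theorem contMDiffAt_tangentBundle_of_inner
    {E₁ : Type*} [NormedAddCommGroup E₁] [NormedSpace ℝ E₁]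
    {H₁ : Type*} [TopologicalSpace H₁] {I₁ : ModelWithCorners ℝ E₁ H₁}
    {N : Type*} [TopologicalSpace N] [ChartedSpace H₁ N] {f : N → TangentBundle I M} {x : N}
    (h1 : ContMDiffAt I₁ I ∞ (fun y => (f y).1) x)
    (h2 : ∀ a : E, ContMDiffAt I₁ 𝓘(ℝ, ℝ) ∞ (fun y => (inner ℝ (f y).2
      ((trivializationAt E (fun x : M => TangentSpace I x) (f x).1).symmL ℝ (f y).1 a) : ℝ)) x) :
    ContMDiffAt I₁ I.tangent ∞ f x := by
  set t := trivializationAt E (fun x : M => TangentSpace I x) (f x).1 with ht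
  have hmem : ∀ᶠ y in nhds x, (f y).1 ∈ t.baseSet :=
    h1.continuousAt.eventually
      (t.open_baseSet.mem_nhds (FiberBundle.mem_baseSet_trivializationAt' _))
  have hs : ∀ a : E, ContMDiffAt I₁ I.tangent ∞
      (fun y => (⟨(f y).1, t.symmL ℝ (f y).1 a⟩ : TangentBundle I M)) x := fun a =>
    ContMDiffAt.comp (g := fun p : M => (⟨p, t.symmL ℝ p a⟩ : TangentBundle I M)) x
      (contMDiffAt_symm_trivializationAt (f x).1 a) h1
  have hgram : ContMDiffAt I₁ 𝓘(ℝ, E →L[ℝ] E →L[ℝ] ℝ) ∞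
      (fun y => gramMap (t.symmL ℝ (f y).1)) x :=
    contMDiffAt_clm_of_apply fun a => contMDiffAt_clm_of_apply fun b =>
      ContMDiffAt.inner_bundle (F := E) (E := fun x : M => TangentSpace I x)
        (b := fun y => (f y).1) (hs a) (hs b)
  have hc : ContMDiffAt I₁ 𝓘(ℝ, E →L[ℝ] ℝ) ∞
      (fun y => ((innerSL ℝ (f y).2).comp (t.symmL ℝ (f y).1) : E →L[ℝ] ℝ)) x :=
    contMDiffAt_clm_of_apply h2
  have hinj : ∀ y, (f y).1 ∈ t.baseSet → Function.Injective (t.symmL ℝ (f y).1) := fun y hy =>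
    Function.LeftInverse.injective (t.continuousLinearMapAt_symmL hy)
  obtain ⟨e, he⟩ := exists_equiv_gramMap (hinj x hmem.self_of_nhds)
  have hi : ContMDiffAt I₁ 𝓘(ℝ, (E →L[ℝ] ℝ) →L[ℝ] E) ∞
      (fun y => (gramMap (t.symmL ℝ (f y).1)).inverse) x := by
    haveI : CompleteSpace E := FiniteDimensional.complete ℝ E
    have h := contDiffAt_map_inverse (n := ∞) e
    rw [he] at h
    exact ContMDiffAt.comp (g := ContinuousLinearMap.inverse) x h.contMDiffAt hgram
  rw [Bundle.contMDiffAt_totalSpace]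
  refine ⟨h1, (hi.clm_apply hc).congr_of_eventuallyEq ?_⟩
  filter_upwards [hmem] with y hy
  obtain ⟨e', he'⟩ := exists_equiv_gramMap (hinj y hy)
  rw [← he', ContinuousLinearMap.inverse_equiv, ContinuousLinearEquiv.coe_coe,
    ContinuousLinearEquiv.eq_symm_apply]
  ext b
  have h3 : e' (t (f y)).2 b = gramMap (t.symmL ℝ (f y).1) (t (f y)).2 b := by rw [← he']; rfl
  refine h3.trans ?_
  rw [gramMap_apply]
  have h4 : t.symmL ℝ (f y).1 (t (f y)).2 = (f y).2 := by
    have := t.symmL_continuousLinearMapAt (R := ℝ) hy (f y).2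
    rw [t.continuousLinearMapAt_apply_of_mem ℝ hy] at this
    exact this
  rw [h4]
  rfl

variable {E' : Type*} [NormedAddCommGroup E'] [NormedSpace ℝ E']
  {H' : Type*} [TopologicalSpace H'] {I' : ModelWithCorners ℝ E' H'}
  {B : Type*} [TopologicalSpace B] [ChartedSpace H' B] [IsManifold I' ∞ B]
  [Bundle.RiemannianBundle (fun x : B => TangentSpace I' x)]
  [IsContMDiffRiemannianBundle I' ∞ E' (fun x : B => TangentSpace I' x)]

/-- The horizontal lift of a tangent vector under a Riemannian submersion: the adjoint of the
differential. -/
def horizontalLift (q : M → B) (p : M) (w : TangentSpace I' (q p)) : TangentSpace I p :=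
  haveI : FiniteDimensional ℝ (TangentSpace I p) := inferInstanceAs (FiniteDimensional ℝ E)
  haveI : CompleteSpace (TangentSpace I p) := FiniteDimensional.complete ℝ _
  (InnerProductSpace.toDual ℝ (TangentSpace I p)).symm ((innerSL ℝ w).comp (mfderiv I I' q p))

theorem inner_horizontalLift (q : M → B) (p : M) (w : TangentSpace I' (q p))
    (x : TangentSpace I p) : inner ℝ (horizontalLift q p w) x = inner ℝ w (mfderiv I I' q p x) := by
  haveI : FiniteDimensional ℝ (TangentSpace I p) := inferInstanceAs (FiniteDimensional ℝ E)
  haveI : CompleteSpace (TangentSpace I p) := FiniteDimensional.complete ℝ _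
  exact InnerProductSpace.toDual_symm_apply

theorem isHorizontal_horizontalLift (q : M → B) (p : M) (w : TangentSpace I' (q p)) :
    IsHorizontal I I' q p (horizontalLift q p w) := by
  intro x hx
  rw [inner_horizontalLift, hx, inner_zero_right]

theorem contMDiff_horizontalLift (q : ContMDiffMap I I' M B ∞) :
    ContMDiff (I.prod 𝓘(ℝ, E')) I.tangent ∞ (fun y : PullbackTangentBundle q =>
      (⟨y.1, horizontalLift q y.1 y.2⟩ : TangentBundle I M)) := by
  intro y
  have hp : ContMDiff (I.prod 𝓘(ℝ, E')) I ∞ (fun y : PullbackTangentBundle q => y.1) :=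
    Bundle.contMDiff_proj _
  refine contMDiffAt_tangentBundle_of_inner hp.contMDiffAt fun a => ?_
  have h1 := (q.contMDiff.contMDiffAt (x := y.1)).mfderiv_apply_section
    (contMDiffAt_symm_trivializationAt y.1 a)
  have h2 := ContMDiffAt.comp y h1 hp.contMDiffAt
  have h3 := ContMDiffAt.inner_bundle (F := E') (E := fun x : B => TangentSpace I' x)
    (b := fun z : PullbackTangentBundle q => q z.1)
    (v := fun z => z.2) (w := fun z => mfderiv I I' q z.1 ((trivializationAt E
      (fun x : M => TangentSpace I x) y.1).symmL ℝ z.1 a))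
    (contMDiff_pullbackTangentBundle_lift q y) h2
  exact h3.congr_of_eventuallyEq (.of_forall fun z => inner_horizontalLift q z.1 z.2 _)

/-! ### The differential of a Riemannian submersion on horizontal vectors -/

namespace IsRiemannianSubmersion

variable [I.Boundaryless] [I'.Boundaryless] {q : M → B} (hq : IsRiemannianSubmersion I I' q)
include hq

theorem exists_isHorizontal_mfderiv_eq (p : M) (w : TangentSpace I' (q p)) :
    ∃ u : TangentSpace I p, IsHorizontal I I' q p u ∧ mfderiv I I' q p u = w := by
  haveI : FiniteDimensional ℝ (TangentSpace I p) := inferInstanceAs (FiniteDimensional ℝ E)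
  obtain ⟨x, hx⟩ := hq.isSubmersion.mfderiv_surjective p w
  let K : Submodule ℝ (TangentSpace I p) := LinearMap.ker (mfderiv I I' q p).toLinearMap
  obtain ⟨k, hk, u, hu, rfl⟩ := K.exists_add_mem_mem_orthogonal x
  refine ⟨u, fun y hy => ?_, ?_⟩
  · rw [real_inner_comm]
    exact hu y hy
  · have hk' : mfderiv I I' q p k = 0 := hk
    rw [map_add, hk', zero_add] at hx
    exact hx

theorem mfderiv_horizontalLift (p : M) (w : TangentSpace I' (q p)) :
    mfderiv I I' q p (horizontalLift q p w) = w := by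
  refine ext_inner_right ℝ fun y => ?_
  obtain ⟨u, hu, rfl⟩ := hq.exists_isHorizontal_mfderiv_eq p y
  rw [hq.isometric p _ _ (isHorizontal_horizontalLift q p w) hu, inner_horizontalLift]

theorem horizontalLift_mfderiv {p : M} {v : TangentSpace I p} (hv : IsHorizontal I I' q p v) :
    horizontalLift q p (mfderiv I I' q p v) = v := by
  have hd : mfderiv I I' q p (horizontalLift q p (mfderiv I I' q p v) - v) = 0 := by
    rw [map_sub, hq.mfderiv_horizontalLift, sub_self]
  rw [← sub_eq_zero, ← inner_self_eq_zero (𝕜 := ℝ), inner_sub_left, hv _ hd,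
    isHorizontal_horizontalLift q p _ _ hd, sub_zero]

theorem inner_mfderiv {p : M} {v : TangentSpace I p} (hv : IsHorizontal I I' q p v)
    (x : TangentSpace I p) :
    inner ℝ (mfderiv I I' q p v) (mfderiv I I' q p x) = inner ℝ v x := by
  rw [← inner_horizontalLift, hq.horizontalLift_mfderiv hv]

end IsRiemannianSubmersion

end

/-! ### The space of horizontal vectors -/

section

variable {E : Type*} [NormedAddCommGroup E] [NormedSpace ℝ E] [FiniteDimensional ℝ E]
  {H : Type*} [TopologicalSpace H] {I : ModelWithCorners ℝ E H} [I.Boundaryless]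
  {M : Type*} [TopologicalSpace M] [ChartedSpace H M] [IsManifold I ∞ M]
  [Bundle.RiemannianBundle (fun x : M => TangentSpace I x)]
  [IsContMDiffRiemannianBundle I ∞ E (fun x : M => TangentSpace I x)]
  {E' : Type*} [NormedAddCommGroup E'] [NormedSpace ℝ E'] [FiniteDimensional ℝ E']
  {H' : Type*} [TopologicalSpace H'] {I' : ModelWithCorners ℝ E' H'} [I'.Boundaryless]
  {B : Type*} [TopologicalSpace B] [ChartedSpace H' B] [IsManifold I' ∞ B]
  [Bundle.RiemannianBundle (fun x : B => TangentSpace I' x)]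
  [IsContMDiffRiemannianBundle I' ∞ E' (fun x : B => TangentSpace I' x)]
  (q : ContMDiffMap I I' M B ∞)

/-- The differential of `q`, as a map to the pullback of the tangent bundle of the target. -/
def tangentMapPullback (v : TangentBundle I M) : PullbackTangentBundle q :=
  ⟨v.1, mfderiv I I' q v.1 v.2⟩

theorem contMDiff_tangentMapPullback :
    ContMDiff I.tangent (I.prod 𝓘(ℝ, E')) ∞ (tangentMapPullback q) := fun v =>
  contMDiffAt_pullbackTangentBundle q (Bundle.contMDiff_proj _ v)
    (q.contMDiff.contMDiff_tangentMap (m := ∞) (by simp) v)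

theorem PullbackTangentBundle.ext_lift {y z : PullbackTangentBundle q} (h : y.1 = z.1)
    (h' : lift q y = lift q z) : y = z := by
  obtain ⟨p, w⟩ := y
  obtain ⟨p', w'⟩ := z
  obtain rfl : p = p' := h
  exact congrArg (Bundle.TotalSpace.mk p) (eq_of_heq (Bundle.TotalSpace.mk.inj h').2)

variable {q} (hq : IsRiemannianSubmersion I I' q) {S : Set (TangentBundle I M)}
  (hS : S = {v : TangentBundle I M | IsHorizontal I I' q v.1 v.2})

/-- The horizontal vectors are parametrized by the pullback of the tangent bundle of the base. -/
def horizontalHomeomorph : S ≃ₜ PullbackTangentBundle q where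
  toFun v := tangentMapPullback q v
  invFun y := ⟨⟨y.1, horizontalLift q y.1 y.2⟩,
    (Set.ext_iff.1 hS _).2 (isHorizontal_horizontalLift q y.1 y.2)⟩
  left_inv v := by
    have hv : IsHorizontal I I' q v.1.1 v.1.2 := (Set.ext_iff.1 hS v.1).1 v.2
    exact Subtype.ext (congrArg (Bundle.TotalSpace.mk v.1.1) (hq.horizontalLift_mfderiv hv))
  right_inv y := congrArg (Bundle.TotalSpace.mk y.1) (hq.mfderiv_horizontalLift y.1 y.2)
  continuous_toFun := (contMDiff_tangentMapPullback q).continuous.comp continuous_subtype_val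
  continuous_invFun := (contMDiff_horizontalLift q).continuous.subtype_mk _

/-- The smooth structure of the space of horizontal vectors. -/
@[reducible]
def horizontalChartedSpace : ChartedSpace (ModelProd H E') S :=
  (horizontalHomeomorph hq hS).transportChartedSpace

theorem isManifold_horizontal :
    letI := horizontalChartedSpace hq hS
    IsManifold (I.prod 𝓘(ℝ, E')) ∞ S :=
  (horizontalHomeomorph hq hS).isManifold_transport

/-- The parametrization of the horizontal vectors as a diffeomorphism. -/
def horizontalDiffeomorph :
    letI := horizontalChartedSpace hq hS
    Diffeomorph (I.prod 𝓘(ℝ, E')) (I.prod 𝓘(ℝ, E')) S (PullbackTangentBundle q) ∞ :=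
  (horizontalHomeomorph hq hS).transportDiffeomorph

theorem contMDiff_val_horizontal :
    letI := horizontalChartedSpace hq hS
    ContMDiff (I.prod 𝓘(ℝ, E')) I.tangent ∞ (Subtype.val : S → TangentBundle I M) := by
  letI := horizontalChartedSpace hq hS
  refine ((contMDiff_horizontalLift q).comp (horizontalDiffeomorph hq hS).contMDiff).congr
    fun v => ?_
  exact congrArg Subtype.val ((horizontalHomeomorph hq hS).left_inv v).symm

theorem injective_mfderiv_val_horizontal (z : S) :
    letI := horizontalChartedSpace hq hS
    Function.Injective (mfderiv (I.prod 𝓘(ℝ, E')) I.tangent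
      (Subtype.val : S → TangentBundle I M) z) := by
  letI := horizontalChartedSpace hq hS
  haveI := isManifold_horizontal hq hS
  have e := mfderiv_comp (I := I.prod 𝓘(ℝ, E')) (I' := I.tangent) (I'' := I.prod 𝓘(ℝ, E')) z
    ((contMDiff_tangentMapPullback q).mdifferentiable (by simp) z.1)
    ((contMDiff_val_horizontal hq hS).mdifferentiable (by simp) z)
  have h := ((horizontalDiffeomorph hq hS).mfderivToContinuousLinearEquiv (by simp) z).injective
  have h' : Function.Injective (mfderiv (I.prod 𝓘(ℝ, E')) (I.prod 𝓘(ℝ, E'))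
    (tangentMapPullback q ∘ (Subtype.val : S → TangentBundle I M)) z) := h
  rw [e] at h'
  exact Function.Injective.of_comp h'

/-- The differential of `q` on horizontal vectors. -/
def horizontalToTangent (v : S) : TangentBundle I' B := tangentMap I I' q v

theorem isSubmersionOfComplement_horizontalToTangent :
    letI := horizontalChartedSpace hq hS
    Manifold.IsSubmersionOfComplement hq.isSubmersion.complement (I.prod 𝓘(ℝ, E')) I'.tangent ∞
      (horizontalToTangent (q := q) : S → TangentBundle I' B) := by
  letI := horizontalChartedSpace hq hS
  haveI := isManifold_horizontal hq hS
  exact (isSubmersionOfComplement_pullbackTangentBundle_lift q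
    hq.isSubmersion.isSubmersionOfComplement_complement).conj_diffeomorph
      (horizontalDiffeomorph hq hS) (Diffeomorph.refl _ _ _)

theorem pullback_horizontalToTangent_metricForm :
    letI := horizontalChartedSpace hq hS
    MForm.pullback (I.prod 𝓘(ℝ, E')) I'.tangent (horizontalToTangent (q := q) : S → _)
        (metricForm I' B) =
      MForm.pullback (I.prod 𝓘(ℝ, E')) I.tangent (Subtype.val : S → TangentBundle I M)
        (metricForm I M) := by
  letI := horizontalChartedSpace hq hS
  haveI := isManifold_horizontal hq hS
  have hF := isSubmersionOfComplement_horizontalToTangent hq hS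
  funext v
  ext w
  rw [MForm.pullback_apply, MForm.pullback_apply, metricForm_apply, metricForm_apply]
  have hv : IsHorizontal I I' q v.1.1 v.1.2 := (Set.ext_iff.1 hS v.1).1 v.2
  have e1 := mfderiv_comp (I := I.prod 𝓘(ℝ, E')) (I' := I'.tangent) (I'' := I')
    (g := (Bundle.TotalSpace.proj : TangentBundle I' B → B))
    (f := (horizontalToTangent (q := q) : S → _)) v
    ((Bundle.contMDiff_proj (n := 1) _).mdifferentiable (by simp) _)
    (hF.contMDiff.mdifferentiable (by simp) v)
  have e2 := mfderiv_comp (I := I.prod 𝓘(ℝ, E')) (I' := I.tangent) (I'' := I)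
    (g := (Bundle.TotalSpace.proj : TangentBundle I M → M))
    (f := (Subtype.val : S → TangentBundle I M)) v
    ((Bundle.contMDiff_proj (n := 1) _).mdifferentiable (by simp) _)
    ((contMDiff_val_horizontal hq hS).mdifferentiable (by simp) v)
  have e3 := mfderiv_comp (I := I.prod 𝓘(ℝ, E')) (I' := I) (I'' := I') (g := q)
    (f := (Bundle.TotalSpace.proj : TangentBundle I M → M) ∘ (Subtype.val : S → TangentBundle I M))
    v (q.contMDiff.mdifferentiable (by simp) _)
    (((Bundle.contMDiff_proj (n := 1) _).mdifferentiable (by simp) _).comp v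
      ((contMDiff_val_horizontal hq hS).mdifferentiable (by simp) v))
  rw [e2] at e3
  have e4 := congrArg (fun A : E × E' →L[ℝ] E' => A (w 0)) (e1.symm.trans e3)
  exact (congrArg (fun u : E' => @inner ℝ (TangentSpace I' (q v.1.1)) _
    (mfderiv I I' q v.1.1 v.1.2) u) e4).trans (hq.inner_mfderiv hv _)

theorem pullback_horizontalToTangent_tangentSymplecticForm :
    letI := horizontalChartedSpace hq hS
    MForm.pullback (I.prod 𝓘(ℝ, E')) I'.tangent (horizontalToTangent (q := q) : S → _)
        (tangentSymplecticForm I' B) =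
      MForm.pullback (I.prod 𝓘(ℝ, E')) I.tangent (Subtype.val : S → TangentBundle I M)
        (tangentSymplecticForm I M) := by
  letI := horizontalChartedSpace hq hS
  haveI := isManifold_horizontal hq hS
  have hF := isSubmersionOfComplement_horizontalToTangent hq hS
  rw [tangentSymplecticForm_eq, tangentSymplecticForm_eq, MForm.pullback_neg, MForm.pullback_neg,
    ← isSmooth_metricForm.extDeriv_pullback hF.contMDiff,
    ← isSmooth_metricForm.extDeriv_pullback (contMDiff_val_horizontal hq hS),
    pullback_horizontalToTangent_metricForm hq hS]

end

/-! ### Symplectic forms and diffeomorphisms -/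

section

variable {E : Type*} [NormedAddCommGroup E] [NormedSpace ℝ E] [FiniteDimensional ℝ E]
  {H : Type*} [TopologicalSpace H] {I : ModelWithCorners ℝ E H} [I.Boundaryless]
  {X : Type*} [TopologicalSpace X] [ChartedSpace H X] [IsManifold I ∞ X]
  {Y : Type*} [TopologicalSpace Y] [ChartedSpace H Y] [IsManifold I ∞ Y]

theorem MForm.IsSymplectic.pullback_diffeomorph {η : MForm I Y 2} (hη : η.IsSymplectic I)
    (d : Diffeomorph I I X Y ∞) : (MForm.pullback I I d η).IsSymplectic I where
  smooth := hη.smooth.pullback d.contMDiff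
  closed := by
    rw [hη.smooth.extDeriv_pullback d.contMDiff, hη.closed]
    rfl
  nondegenerate x u hu := by
    have hb : Function.Bijective (mfderiv I I d x) :=
      (d.mfderivToContinuousLinearEquiv (by simp) x).bijective
    refine hb.1 ((hη.nondegenerate (d x) _ fun v => ?_).trans (map_zero (mfderiv I I d x)).symm)
    obtain ⟨w, rfl⟩ := hb.2 v
    refine Eq.trans (congrArg (η (d x)) (funext fun i => ?_)) (hu w)
    fin_cases i <;> rfl

end

/-! ### Moment maps of locally free actions are submersions -/

section

variable {EG : Type*} [NormedAddCommGroup EG] [NormedSpace ℝ EG] [FiniteDimensional ℝ EG]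
  {HG : Type*} [TopologicalSpace HG] {IG : ModelWithCorners ℝ EG HG}
  {G : Type*} [TopologicalSpace G] [ChartedSpace HG G] [Group G]
  {E : Type*} [NormedAddCommGroup E] [NormedSpace ℝ E]
  {H : Type*} [TopologicalSpace H] {I : ModelWithCorners ℝ E H}
  {X : Type*} [TopologicalSpace X] [ChartedSpace H X] [MulAction G X]

/-- A linear map into a dual space is surjective if no nonzero vector is annihilated by its
range. -/
theorem surjective_of_forall_eq_zero {V : Type*} [AddCommGroup V] [Module ℝ V]
    (A : V →ₗ[ℝ] EG →L[ℝ] ℝ) (h : ∀ ξ : EG, (∀ v, A v ξ = 0) → ξ = 0) :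
    Function.Surjective A := by
  rw [← LinearMap.range_eq_top]
  by_contra hne
  obtain ⟨f, hf, hle⟩ := Submodule.exists_le_ker_of_lt_top _ (lt_top_iff_ne_top.2 hne)
  let L : (EG →ₗ[ℝ] ℝ) ≃ₗ[ℝ] EG →L[ℝ] ℝ := LinearMap.toContinuousLinearMap
  obtain ⟨ξ, hξ⟩ := (Module.evalEquiv ℝ EG).surjective (f ∘ₗ L.toLinearMap)
  have hev : ∀ φ : EG →L[ℝ] ℝ, f φ = φ ξ := by
    intro φ
    have h1 := DFunLike.congr_fun hξ (L.symm φ)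
    have h2 : f (L (L.symm φ)) = (L.symm φ) ξ := h1.symm
    rwa [L.apply_symm_apply] at h2
  refine hf (LinearMap.ext fun φ => ?_)
  rw [hev, h ξ fun v => ?_, map_zero]
  · rfl
  · rw [← hev]
    exact hle ⟨v, rfl⟩

theorem IsHamiltonianAction.surjective_mfderiv {η : MForm I X 2} {Φ : X → EG →L[ℝ] ℝ}
    (h : IsHamiltonianAction IG I G η Φ) {x : X}
    (hx : Function.Injective (infinitesimalAction IG G I x)) :
    Function.Surjective (mfderiv I 𝓘(ℝ, EG →L[ℝ] ℝ) Φ x) := by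
  refine surjective_of_forall_eq_zero
    (mfderiv I 𝓘(ℝ, EG →L[ℝ] ℝ) Φ x : TangentSpace I x →L[ℝ] EG →L[ℝ] ℝ).toLinearMap
    fun ξ hξ => ?_
  refine (map_eq_zero_iff _ hx).1 (h.isSymplectic.nondegenerate x _ fun w => ?_)
  rw [← h.moment ξ x w]
  have e := mfderiv_comp (I := I) (I' := 𝓘(ℝ, EG →L[ℝ] ℝ)) (I'' := 𝓘(ℝ, ℝ))
    (g := ContinuousLinearMap.apply ℝ ℝ ξ) (f := Φ) x
    (ContinuousLinearMap.mdifferentiableAt _) (h.contMDiff.mdifferentiable (by simp) x)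
  rw [ContinuousLinearMap.mfderiv_eq] at e
  refine (congrArg (fun A : E →L[ℝ] ℝ => A w) e).trans ?_
  exact hξ w

end

/-! ### Reduction -/

section

variable {EG : Type*} [NormedAddCommGroup EG] [NormedSpace ℝ EG] [FiniteDimensional ℝ EG]
  {HG : Type*} [TopologicalSpace HG] {IG : ModelWithCorners ℝ EG HG} [IG.Boundaryless]
  {G : Type*} [TopologicalSpace G] [ChartedSpace HG G] [Group G] [LieGroup IG ∞ G]
  {E : Type*} [NormedAddCommGroup E] [NormedSpace ℝ E] [FiniteDimensional ℝ E]
  {H : Type*} [TopologicalSpace H] {I : ModelWithCorners ℝ E H} [I.Boundaryless]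
  {M : Type*} [TopologicalSpace M] [ChartedSpace H M] [IsManifold I ∞ M]
  [MulAction G M] [ContMDiffSMul IG I ∞ G M]
  [Bundle.RiemannianBundle (fun x : M => TangentSpace I x)]
  [IsContMDiffRiemannianBundle I ∞ E (fun x : M => TangentSpace I x)]
  {E' : Type*} [NormedAddCommGroup E'] [NormedSpace ℝ E'] [FiniteDimensional ℝ E']
  {H' : Type*} [TopologicalSpace H'] {I' : ModelWithCorners ℝ E' H'} [I'.Boundaryless]
  {B : Type*} [TopologicalSpace B] [ChartedSpace H' B] [IsManifold I' ∞ B]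
  [Bundle.RiemannianBundle (fun x : B => TangentSpace I' x)]
  [IsContMDiffRiemannianBundle I' ∞ E' (fun x : B => TangentSpace I' x)]

theorem infinitesimalAction_tangentAction_injective
    (free : ∀ (g : G) (p : M), g • p = p → g = 1) (v : TangentBundle I M) :
    letI : MulAction G (TangentBundle I M) := tangentAction IG G I M
    Function.Injective (infinitesimalAction IG G I.tangent v) := by
  letI : MulAction G (TangentBundle I M) := tangentAction IG G I M
  rw [injective_iff_map_eq_zero]
  intro ξ hξ
  refine (map_eq_zero_iff _ (infinitesimalAction_injective (IG := IG) (I := I) free v.1)).1 ?_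
  rw [← mfderiv_proj_infinitesimalAction, hξ, map_zero]

variable {q : ContMDiffMap I I' M B ∞} (hq : IsRiemannianSubmersion I I' q)
  {S : Set (TangentBundle I M)} (hS : S = {v : TangentBundle I M | IsHorizontal I I' q v.1 v.2})
  (orbit : ∀ x y, q x = q y ↔ ∃ g : G, g • y = x)

include hq hS orbit in
/-- The fibres of the differential of `q` on horizontal vectors are the orbits. -/
theorem horizontalToTangent_eq_iff
    (hinv : letI : MulAction G (TangentBundle I M) := tangentAction IG G I M
      ∀ (g : G), ∀ v ∈ S, g • v ∈ S) (v w : S) :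
    letI : MulAction G (TangentBundle I M) := tangentAction IG G I M
    horizontalToTangent (q := q) v = horizontalToTangent (q := q) w ↔ ∃ g : G, g • w.1 = v.1 := by
  letI : MulAction G (TangentBundle I M) := tangentAction IG G I M
  have hg : ∀ (g : G) (u : TangentBundle I M), tangentMap I I' q (g • u) = tangentMap I I' q u := by
    intro g u
    have e : q ∘ (fun x : M => g • x) = q := funext fun x => (orbit _ _).2 ⟨g, rfl⟩
    have := tangentMap_comp_at (I := I) (I' := I) (I'' := I') (g := q) (f := fun x : M => g • x) u
      (q.contMDiff.mdifferentiable (by simp) _) (mdifferentiable_const_smul IG g _)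
    rw [e] at this
    exact this.symm
  constructor
  · intro h
    obtain ⟨g, hg1⟩ := (orbit v.1.1 w.1.1).1 (congrArg Bundle.TotalSpace.proj h)
    refine ⟨g, ?_⟩
    have h1 : tangentMapPullback q (g • w.1) = tangentMapPullback q v.1 :=
      PullbackTangentBundle.ext_lift q hg1 ((hg g w.1).trans h.symm)
    exact congrArg Subtype.val ((horizontalHomeomorph hq hS).injective
      (a₁ := ⟨g • w.1, hinv g _ w.2⟩) (a₂ := v) h1)
  · rintro ⟨g, h⟩
    unfold horizontalToTangent
    rw [← h, hg]

include hq hS in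
theorem surjective_horizontalToTangent (hsurj : Function.Surjective q) :
    Function.Surjective (horizontalToTangent (q := q) : S → TangentBundle I' B) := by
  rintro ⟨b, w⟩
  obtain ⟨p, rfl⟩ := hsurj b
  exact ⟨⟨⟨p, horizontalLift q p w⟩, (Set.ext_iff.1 hS _).2 (isHorizontal_horizontalLift q p w)⟩,
    congrArg (Bundle.TotalSpace.mk (q p)) (hq.mfderiv_horizontalLift p w)⟩

theorem exists_homeomorph_quotient {X Y : Type*} [TopologicalSpace X] [TopologicalSpace Y]
    {s : Setoid X} {f : X → Y} (hc : Continuous f) (ho : IsOpenMap f)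
    (hs : Function.Surjective f) (h : ∀ x y, f x = f y ↔ s x y) :
    ∃ e : Quotient s ≃ₜ Y, ∀ x, e (Quotient.mk s x) = f x := by
  let F : Quotient s → Y := Quotient.lift f fun x y hxy => (h x y).2 hxy
  have hinj : Function.Injective F := by
    rintro ⟨x⟩ ⟨y⟩ hxy
    exact Quotient.sound ((h x y).1 hxy)
  have hsurj : Function.Surjective F := fun y => by
    obtain ⟨x, rfl⟩ := hs y
    exact ⟨Quotient.mk s x, rfl⟩
  have hcont : Continuous F := hc.quotient_lift _
  have hopen : IsOpenMap F := fun U hU => by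
    have : F '' U = f '' (Quotient.mk s ⁻¹' U) := by
      ext y
      constructor
      · rintro ⟨⟨x⟩, hx, rfl⟩
        exact ⟨x, hx, rfl⟩
      · rintro ⟨x, hx, rfl⟩
        exact ⟨Quotient.mk s x, hx, rfl⟩
    rw [this]
    exact ho _ (hU.preimage continuous_quotient_mk')
  exact ⟨(Equiv.ofBijective F ⟨hinj, hsurj⟩).toHomeomorphOfContinuousOpen hcont hopen, fun _ => rfl⟩

include hq orbit in
/-- Symplectic reduction of the tangent bundle of the total space of a Riemannian submersion
whose fibres are the orbits of a free isometric action. -/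
theorem exists_reduction [SecondCountableTopology G]
    (free : ∀ (g : G) (p : M), g • p = p → g = 1)
    (isometric : ∀ (g : G) (p : M) (v w : TangentSpace I p),
      inner ℝ (mfderiv I I (fun x : M => g • x) p v) (mfderiv I I (fun x : M => g • x) p w) =
        inner ℝ v w)
    (hsurj : Function.Surjective q) :
    letI : MulAction G (TangentBundle I M) := tangentAction IG G I M
    ∃ R : MarsdenWeinsteinReduction I.tangent (I.prod 𝓘(ℝ, E')) I'.tangent G
        (tangentSymplecticForm I M) (tangentMomentMap IG G I M),
      letI := R.chartedSpaceReduced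
      Symplectomorphic I'.tangent I'.tangent R.form (tangentSymplecticForm I' B) := by
  letI : MulAction G (TangentBundle I M) := tangentAction IG G I M
  have hH := isHamiltonianAction_tangentAction (IG := IG) isometric
  have hS := tangentMomentMap_preimage_zero (IG := IG) free hq.isSubmersion orbit
  have hinv : ∀ (g : G), ∀ v ∈ tangentMomentMap IG G I M ⁻¹' {0},
      g • v ∈ tangentMomentMap IG G I M ⁻¹' {0} := by
    intro g v hv
    have hv' : tangentMomentMap IG G I M v = 0 := hv
    refine ContinuousLinearMap.ext fun ξ => ?_
    rw [hH.equivariant g v ξ, hv']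
    rfl
  letI := horizontalChartedSpace hq hS
  haveI := isManifold_horizontal hq hS
  have hF := isSubmersionOfComplement_horizontalToTangent hq hS
  obtain ⟨h, hh⟩ := exists_homeomorph_quotient
    (s := (MulAction.orbitRel G (TangentBundle I M)).comap
      (Subtype.val : (tangentMomentMap IG G I M ⁻¹' {0} : Set (TangentBundle I M)) → _))
    hF.contMDiff.continuous hF.isSubmersion.isOpenMap
    (surjective_horizontalToTangent hq hS hsurj)
    (fun v w => horizontalToTangent_eq_iff hq hS orbit hinv v w)
  letI : ChartedSpace (ModelProd H' E') (ReducedSpace G (tangentMomentMap IG G I M)) :=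
    h.transportChartedSpace
  haveI : IsManifold I'.tangent ∞ (ReducedSpace G (tangentMomentMap IG G I M)) :=
    h.isManifold_transport
  let d : Diffeomorph I'.tangent I'.tangent (ReducedSpace G (tangentMomentMap IG G I M))
    (TangentBundle I' B) ∞ := h.transportDiffeomorph
  have hmk : d ∘ ReducedSpace.mk G (tangentMomentMap IG G I M) =
      horizontalToTangent (q := q) := funext hh
  have hsub : Manifold.IsSubmersionOfComplement hq.isSubmersion.complement (I.prod 𝓘(ℝ, E'))
      I'.tangent ∞ (ReducedSpace.mk G (tangentMomentMap IG G I M)) := by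
    have := hF.conj_diffeomorph (Diffeomorph.refl _ _ _) d
    rw [← hmk] at this
    convert this using 1
    funext z
    exact (d.symm_apply_apply _).symm
  refine ⟨{
    chartedSpace := horizontalChartedSpace hq hS
    isManifold := isManifold_horizontal hq hS
    contMDiff_val := contMDiff_val_horizontal hq hS
    injective_mfderiv_val := injective_mfderiv_val_horizontal hq hS
    tangent_eq_ker := fun z => ?_
    chartedSpaceReduced := h.transportChartedSpace
    isManifoldReduced := h.isManifold_transport
    isSubmersion := hsub.isSubmersion
    form := MForm.pullback I'.tangent I'.tangent d (tangentSymplecticForm I' B)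
    isSymplectic := (isSymplectic_tangentSymplecticForm I' B).pullback_diffeomorph d
    pullback_form := ?_ }, d, rfl⟩
  · have hzero : tangentMomentMap IG G I M ∘
        (Subtype.val : (tangentMomentMap IG G I M ⁻¹' {0} : Set (TangentBundle I M)) → _) =
        fun _ => 0 := funext fun z => z.2
    have e := mfderiv_comp (I := I.prod 𝓘(ℝ, E')) (I' := I.tangent) (I'' := 𝓘(ℝ, EG →L[ℝ] ℝ)) z
      (hH.contMDiff.mdifferentiable (by simp) _)
      ((contMDiff_val_horizontal hq hS).mdifferentiable (by simp) z)
    rw [hzero, mfderiv_const] at e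
    have hk : ∀ (f : E × E' →L[ℝ] E × E) (g : E × E →L[ℝ] EG →L[ℝ] ℝ), (∀ w, g (f w) = 0) →
        Function.Injective f → Function.Surjective g → Set.range f = {w | g w = 0} := by
      intro f g h0 hf hg
      have h1 := finrank_le_finrank_add_finrank_of_orbit IG (G := G) (p := z.1.1)
        hq.isSubmersion fun x hx => (orbit _ _).1 hx
      have h2 : Module.finrank ℝ (EG →L[ℝ] ℝ) = Module.finrank ℝ EG := by
        rw [← (LinearMap.toContinuousLinearMap (𝕜 := ℝ) (E := EG) (F' := ℝ)).finrank_eq,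
          Module.finrank_linearMap, Module.finrank_self, mul_one]
      have h3 := LinearMap.range_eq_ker_of_finrank_le (f := f.toLinearMap) (g := g.toLinearMap)
        h0 hf hg (by rw [Module.finrank_prod, Module.finrank_prod, h2]; omega)
      exact congrArg (fun W : Submodule ℝ (E × E) => (W : Set (E × E))) h3
    exact hk _ _ (fun w => (congrArg (fun A : E × E' →L[ℝ] EG →L[ℝ] ℝ => A w) e).symm)
      (injective_mfderiv_val_horizontal hq hS z)
      (hH.surjective_mfderiv (infinitesimalAction_tangentAction_injective free z.1))
  · have hcomp : MForm.pullback (I.prod 𝓘(ℝ, E')) I'.tangent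
        (d ∘ ReducedSpace.mk G (tangentMomentMap IG G I M)) (tangentSymplecticForm I' B) =
        MForm.pullback (I.prod 𝓘(ℝ, E')) I'.tangent (ReducedSpace.mk G (tangentMomentMap IG G I M))
          (MForm.pullback I'.tangent I'.tangent d (tangentSymplecticForm I' B)) :=
      funext fun z => MForm.pullback_comp _ (d.contMDiff.mdifferentiable (by simp) _)
        (hsub.contMDiff.mdifferentiable (by simp) z)
    rw [← hcomp, hmk]
    exact pullback_horizontalToTangent_tangentSymplecticForm hq hS

end

end

theorem proposition3p3
    -- a Lie group `G`
    {EG : Type*} [NormedAddCommGroup EG] [NormedSpace ℝ EG] [FiniteDimensional ℝ EG]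
    {G : Type*} [Group G] [TopologicalSpace G] [T2Space G] [SecondCountableTopology G]
    [ChartedSpace EG G] [LieGroup 𝓘(ℝ, EG) ∞ G]
    -- a Riemannian manifold `M`
    {E : Type*} [NormedAddCommGroup E] [NormedSpace ℝ E] [FiniteDimensional ℝ E]
    {M : Type*} [TopologicalSpace M] [T2Space M] [SecondCountableTopology M]
    [ChartedSpace E M] [IsManifold 𝓘(ℝ, E) ∞ M]
    [Bundle.RiemannianBundle (fun x : M => TangentSpace 𝓘(ℝ, E) x)]
    [IsContMDiffRiemannianBundle 𝓘(ℝ, E) ∞ E (fun x : M => TangentSpace 𝓘(ℝ, E) x)]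
    -- a smooth, free and isometric action of `G` on `M`
    [MulAction G M] [ContMDiffSMul 𝓘(ℝ, EG) 𝓘(ℝ, E) ∞ G M]
    (free : ∀ (g : G) (p : M), g • p = p → g = 1)
    (isometric : ∀ (g : G) (p : M) (v w : TangentSpace 𝓘(ℝ, E) p),
      inner ℝ (mfderiv 𝓘(ℝ, E) 𝓘(ℝ, E) (fun x : M => g • x) p v)
        (mfderiv 𝓘(ℝ, E) 𝓘(ℝ, E) (fun x : M => g • x) p w) = inner ℝ v w)
    -- the orbit space `B = M/G` is a manifold and carries the submersion metric
    {EB : Type*} [NormedAddCommGroup EB] [NormedSpace ℝ EB] [FiniteDimensional ℝ EB]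
    [T2Space (MulAction.orbitRel.Quotient G M)]
    [ChartedSpace EB (MulAction.orbitRel.Quotient G M)]
    [IsManifold 𝓘(ℝ, EB) ∞ (MulAction.orbitRel.Quotient G M)]
    [Bundle.RiemannianBundle
      (fun b : MulAction.orbitRel.Quotient G M => TangentSpace 𝓘(ℝ, EB) b)]
    [IsContMDiffRiemannianBundle 𝓘(ℝ, EB) ∞ EB
      (fun b : MulAction.orbitRel.Quotient G M => TangentSpace 𝓘(ℝ, EB) b)]
    (submersion : IsRiemannianSubmersion 𝓘(ℝ, E) 𝓘(ℝ, EB)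
      (fun p : M => (Quotient.mk _ p : MulAction.orbitRel.Quotient G M))) :
    letI : MulAction G (TangentBundle 𝓘(ℝ, E) M) := tangentAction 𝓘(ℝ, EG) G 𝓘(ℝ, E) M
    -- the induced action on `TM` is Hamiltonian with moment map `Φ(v)(ξ) = ⟨v, ξ_M⟩`
    IsHamiltonianAction 𝓘(ℝ, EG) 𝓘(ℝ, E).tangent G (tangentSymplecticForm 𝓘(ℝ, E) M)
        (tangentMomentMap 𝓘(ℝ, EG) G 𝓘(ℝ, E) M) ∧
      -- `Φ⁻¹(0)` is the set of horizontal vectors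
      tangentMomentMap 𝓘(ℝ, EG) G 𝓘(ℝ, E) M ⁻¹' {0} =
        {v : TangentBundle 𝓘(ℝ, E) M | IsHorizontal 𝓘(ℝ, E) 𝓘(ℝ, EB)
          (fun p : M => (Quotient.mk _ p : MulAction.orbitRel.Quotient G M)) v.1 v.2} ∧
      -- `Φ` meets `0` cleanly, the reduced space exists, and it is symplectomorphic to `TB`
      ∃ R : MarsdenWeinsteinReduction 𝓘(ℝ, E).tangent (𝓘(ℝ, E).prod 𝓘(ℝ, EB))
          𝓘(ℝ, EB).tangent G (tangentSymplecticForm 𝓘(ℝ, E) M)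
          (tangentMomentMap 𝓘(ℝ, EG) G 𝓘(ℝ, E) M),
        letI := R.chartedSpaceReduced
        Symplectomorphic 𝓘(ℝ, EB).tangent 𝓘(ℝ, EB).tangent R.form
          (tangentSymplecticForm 𝓘(ℝ, EB) (MulAction.orbitRel.Quotient G M)) := by
  have orbit : ∀ x y : M, (Quotient.mk _ x : MulAction.orbitRel.Quotient G M) = Quotient.mk _ y ↔
      ∃ g : G, g • y = x := fun x y => Quotient.eq
  let q : ContMDiffMap 𝓘(ℝ, E) 𝓘(ℝ, EB) M (MulAction.orbitRel.Quotient G M) ∞ :=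
    ⟨fun p => Quotient.mk _ p, submersion.isSubmersion.contMDiff'⟩
  exact ⟨isHamiltonianAction_tangentAction isometric,
    tangentMomentMap_preimage_zero free submersion.isSubmersion orbit,
    exists_reduction (q := q) submersion orbit free isometric Quotient.mk_surjective⟩
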